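/- Let $p$ be a prime, and let $v_t$ be the $t$-adic valuation of $\mathbb F_p((t))$. There are $x,y\in\mathbb F_p((t))$ that are algebraically independent over $\mathbb F_p(t)$. For every such pair put $s=x^p+ty^p$, let $L_0$ be the relative algebraic closure of $\mathbb F_p(t,s)$ in $\mathbb F_p((t))$, and let $v_0$ be the restriction of $v_t$ to $L_0$. Then $(L_0,v_0)$ is a discretely valued (value group isomorphic to $\mathbb Z$) henselian field of characteristic $p$ which is algebraically maximal, that is, has no nontrivial immediate algebraic extension. It is not inseparably defectless (not every finite purely inseparable extension of it is defectless), and so it is not a defectless field (not every finite unibranched extension of it is defectless). More precisely, let $w$ be any extension of $v_0$ to an algebraic closure of $L_0$, and let $t^{1/p},s^{1/p}$ be the $p$-th roots of $t,s$ there. Then $L_0^{1/p}:=\{z : z^p\in L_0\}=L_0(t^{1/p},s^{1/p})$ is a purely inseparable unibranched extension of $L_0$ with $$[L_0^{1/p}:L_0]=p^2,\qquad (wL_0^{1/p}:wL_0)=p,\qquad [L_0^{1/p}w:L_0w]=1,$$ hence with defect $p$. For each $z\in\{t^{1/p},s^{1/p}\}$ the extension $L_0(z)|L_0$ is purely inseparable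 of degree $p$ and defectless, and the valued field $(L_0(z),w)$ is not algebraically maximal. Here $wF$ and $Fw$ denote the value group and the residue field of $(F,w)$. An extension $(L|K,w)$ is immediate if $wK\to wL$ and $Kw\to Lw$ are onto. It is unibranched if the valuation of $K$ has exactly one extension to $L$ (up to equivalence), and $K$ is henselian if all its algebraic extensions are unibranched. The defect of a finite unibranched extension $(L|K,w)$ is $[L:K]/\bigl((wL:wK)[Lw:Kw]\bigr)$, and the extension is defectless if its defect is $1$. -/

import Mathlib

open scoped IntermediateField LaurentSeries

noncomputable section

namespace ValuedField

open MonoidWithZeroHom IsLocalRing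

universe u

/-! A valued field is a field with a (multiplicatively written) Krull valuation. For an extension
`L|K` and a valuation `w` on `L`, the pair `(L|K, w)` is a valued field extension, where `K` carries
the restriction of `w`, that is `w.comap (algebraMap K L)`. That `w` extends a given valuation `v`
of `K` up to equivalence is `v.HasExtension w`. -/

section Extension

variable {L Γ : Type*} (K : Type*) [Field K] [Field L] [Algebra K L]
  [LinearOrderedCommGroupWithZero Γ] (w : Valuation L Γ)

instance hasExtension_restriction : (w.comap (algebraMap K L)).HasExtension w :=
  ⟨Valuation.IsEquiv.refl⟩

/-- The value group `wK` of the restriction of `w` to `K`, as a subgroup of `Γˣ`; the value group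
`wL` is `valueGroup (.ofClass w)`. -/
def baseValueGroup : Subgroup Γˣ := valueGroup (.ofClass (w.comap (algebraMap K L)))

/-- The ramification index `(wL : wK)`, with the value `0` when it is infinite. -/
def ramificationIndex : ℕ := (baseValueGroup K w).relIndex (valueGroup (.ofClass w))

/-- The residue degree `[Lw : Kw]`, with the value `0` when it is infinite. -/
def residueDegree : ℕ :=
  Module.finrank (ResidueField (w.comap (algebraMap K L)).valuationSubring)
    (ResidueField w.valuationSubring)

/-- The defect `[L : K] / ((wL : wK) [Lw : Kw])` of a finite unibranched extension `(L|K, w)`. By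
the Lemma of Ostrowski it is then a power of the characteristic exponent of the residue field. -/
def defect : ℚ := Module.finrank K L / (ramificationIndex K w * residueDegree K w)

/-- `(L|K, w)` is immediate: the embeddings of value groups and of residue fields are onto. -/
def IsImmediate : Prop :=
  baseValueGroup K w = valueGroup (.ofClass w) ∧
  Function.Surjective
    (algebraMap (ResidueField (w.comap (algebraMap K L)).valuationSubring)
      (ResidueField w.valuationSubring))

end Extension

/- Below, the extensions `L` of `K` and the value groups range over the universe of `K`. As all the
extensions considered are algebraic, this is no restriction: they have a copy in that universe, and
every valuation is equivalent to one whose codomain is its value group with a zero added. -/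

variable {K : Type u} {Γ : Type*} [Field K] [LinearOrderedCommGroupWithZero Γ]

/-- `L|K` is unibranched: `v` has, up to equivalence, exactly one extension to `L`. -/
def IsUnibranched (v : Valuation K Γ) (L : Type u) [Field L] [Algebra K L] : Prop :=
  (∃ (Γ' : Type u) (_ : LinearOrderedCommGroupWithZero Γ') (w : Valuation L Γ'),
    v.HasExtension w) ∧
  ∀ (Γ₁ Γ₂ : Type u) [LinearOrderedCommGroupWithZero Γ₁] [LinearOrderedCommGroupWithZero Γ₂]
    (w₁ : Valuation L Γ₁) (w₂ : Valuation L Γ₂),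
    v.HasExtension w₁ → v.HasExtension w₂ → w₁.IsEquiv w₂

/-- `(K, v)` is henselian: every algebraic extension of `K` is unibranched. -/
def IsHenselian (v : Valuation K Γ) : Prop :=
  ∀ (L : Type u) [Field L] [Algebra K L], Algebra.IsAlgebraic K L → IsUnibranched v L

/-- `(K, v)` is algebraically maximal: it has no nontrivial immediate algebraic extension. -/
def IsAlgebraicallyMaximal (v : Valuation K Γ) : Prop :=
  ∀ (L : Type u) [Field L] [Algebra K L], Algebra.IsAlgebraic K L →
    ∀ (Γ' : Type u) [LinearOrderedCommGroupWithZero Γ'] (w : Valuation L Γ'),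
      v.HasExtension w → IsImmediate K w → Function.Surjective (algebraMap K L)

/-- Every finite purely inseparable extension of `(K, v)` is defectless. -/
def IsInseparablyDefectless (v : Valuation K Γ) : Prop :=
  ∀ (L : Type u) [Field L] [Algebra K L], FiniteDimensional K L → IsPurelyInseparable K L →
    ∀ (Γ' : Type u) [LinearOrderedCommGroupWithZero Γ'] (w : Valuation L Γ'),
      v.HasExtension w → defect K w = 1

/-- Every finite unibranched extension of `(K, v)` is defectless. A henselian field with this
property is called a defectless field. -/
def IsDefectless (v : Valuation K Γ) : Prop :=
  ∀ (L : Type u) [Field L] [Algebra K L], FiniteDimensional K L → IsUnibranched v L →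
    ∀ (Γ' : Type u) [LinearOrderedCommGroupWithZero Γ'] (w : Valuation L Γ'),
      v.HasExtension w → defect K w = 1

end ValuedField

namespace DelonExample

variable (p : ℕ) [Fact p.Prime] (x y : (ZMod p)⸨X⸩)

/-- The indeterminate `t` of `𝔽_p((t))`. -/
def tSeries : (ZMod p)⸨X⸩ := HahnSeries.single 1 1

/-- The element `s = x ^ p + t * y ^ p` of `𝔽_p((t))`. -/
def sSeries : (ZMod p)⸨X⸩ := x ^ p + tSeries p * y ^ p

/-- The subfield `𝔽_p(t)` of `𝔽_p((t))`. -/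
abbrev RatSubfield : IntermediateField (ZMod p) (ZMod p)⸨X⸩ := (ZMod p)⟮tSeries p⟯

/-- The subfield `K = 𝔽_p(t, s)` of `𝔽_p((t))`. -/
abbrev BaseField : IntermediateField (ZMod p) (ZMod p)⸨X⸩ :=
  (ZMod p)⟮tSeries p, sSeries p x y⟯

/-- The relative algebraic closure `L₀` of `K = 𝔽_p(t, s)` in `𝔽_p((t))`. -/
def L₀ : Subfield (ZMod p)⸨X⸩ :=
  (algebraicClosure (BaseField p x y) (ZMod p)⸨X⸩).toSubfield

/-- The restriction `v₀` to `L₀` of the `t`-adic valuation of `𝔽_p((t))`. -/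
def v₀ : Valuation (L₀ p x y) (WithZero (Multiplicative ℤ)) :=
  (Valued.v : Valuation (ZMod p)⸨X⸩ (WithZero (Multiplicative ℤ))).comap (L₀ p x y).subtype

lemma mem_L₀ {z : (ZMod p)⸨X⸩} (hz : z ∈ BaseField p x y) : z ∈ L₀ p x y :=
  (algebraicClosure (BaseField p x y) (ZMod p)⸨X⸩).algebraMap_mem ⟨z, hz⟩

/-- `t` as an element of `L₀`. -/
def t : L₀ p x y :=
  ⟨tSeries p, mem_L₀ p x y (IntermediateField.subset_adjoin _ _ (by simp))⟩

/-- `s` as an element of `L₀`. -/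
def s : L₀ p x y :=
  ⟨sSeries p x y, mem_L₀ p x y (IntermediateField.subset_adjoin _ _ (by simp))⟩

end DelonExample

end

/-! Write F = 𝔽_p((t)) and K = 𝔽_p(t, s). Relative closedness in F makes L₀ look maximal, while its
field of p-th roots is larger than the valuation can account for.

Since L₀ is relatively algebraically closed in the complete field F, every extension of v₀ to an
algebraic extension is induced by the spectral norm over F (`isEquiv_comap_spectralValuation`), so
L₀ is henselian. In an immediate algebraic extension, discreteness lets each element be approximated
arbitrarily well from L₀. By completeness the element then lies in F, hence in L₀, so L₀ is
algebraically maximal.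

As t is not a p-th power in F, the powers 1, t, ..., t^(p-1) are independent over F^p. If s = ∑
c_i^p t^i with c_i in L₀, comparison with s = x^p + t y^p forces c_0 = x and c_1 = y. Then x and y
are algebraic over 𝔽_p(t)(s), which has transcendence degree at most 1 over 𝔽_p(t): a contradiction
(`sum_pow_mul_pow_ne_s`). So t, s are p-independent in L₀, and L₀(t^(1/p), s^(1/p)) has degree p².

The monomials t^i s^j with i, j < p span K over K^p and stay independent over L₀^p, so L₀|K is
separable (`isSeparable_of_independent`). Thus a ∈ K(a^p) for every a in L₀, and all p-th roots of
L₀ lie in L₀(t^(1/p), s^(1/p)) (`exists_pow_eq_algebraMap`).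

Raising to the p-th power carries L₀^(1/p) onto L₀, so its values are the p-th roots of those of L₀
and its residue field is still 𝔽_p. Hence the defect is p²/p = p. Each of the two degree-p
subextensions already contains an element n with w(n)^p = w(t) (for s^(1/p), see
`exists_valuation_pow_eq`). It is therefore defectless, and L₀^(1/p) is a proper immediate extension
of it. -/

open scoped NNReal

/-! ### Spectral norms and relatively algebraically closed subfields of complete fields -/

namespace ValuedField

/-- The spectral norm on an algebraic extension of a complete ultrametric field, as a valuation. -/
noncomputable def spectralValuation (F L : Type*) [NontriviallyNormedField F] [IsUltrametricDist F]
    [CompleteSpace F] [Field L] [Algebra F L] [Algebra.IsAlgebraic F L] : Valuation L ℝ≥0 where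
  toFun x := ⟨spectralNorm F L x, spectralNorm_nonneg x⟩
  map_zero' := Subtype.ext spectralNorm_zero
  map_one' := Subtype.ext spectralNorm_one
  map_mul' x y := Subtype.ext (spectralAlgNorm_mul x y)
  map_add_le_max' x y := isNonarchimedean_spectralNorm x y

section SpectralValuation

variable {F L : Type*} [NontriviallyNormedField F] [IsUltrametricDist F]
  [CompleteSpace F] [Field L] [Algebra F L] [Algebra.IsAlgebraic F L]

lemma spectralValuation_algebraMap (c : F) : spectralValuation F L (algebraMap F L c) = ‖c‖₊ :=
  Subtype.ext (spectralNorm_extends c)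

/-- A complete field is closed in its algebraic extensions. -/
lemma mem_range_of_forall_exists_spectralValuation_sub_lt (a : L)
    (h : ∀ ε : ℝ≥0, 0 < ε → ∃ c : F, spectralValuation F L (a - algebraMap F L c) < ε) :
    a ∈ Set.range (algebraMap F L) := by
  let : NormedField L := spectralNorm.normedField F L
  have hiso : Isometry (algebraMap F L) := by
    refine Isometry.of_dist_eq fun x y ↦ ?_
    change spectralNorm F L (_ - _) = _
    rw [← map_sub, spectralNorm_extends, dist_eq_norm]
  rw [← hiso.isClosedEmbedding.isClosed_range.closure_eq, Metric.mem_closure_iff]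
  intro ε hε
  obtain ⟨c, hc⟩ := h ⟨ε, hε.le⟩ hε
  exact ⟨_, ⟨c, rfl⟩, hc⟩

end SpectralValuation

/-- The valuation ring of `w` is integrally closed. -/
lemma valuation_le_one_of_aeval_eq_zero {k L Γ : Type*} [Field k] [Field L] [Algebra k L]
    [LinearOrderedCommGroupWithZero Γ] (w : Valuation L Γ) {q : Polynomial k} (hq : q.Monic)
    (hc : ∀ i, w (algebraMap k L (q.coeff i)) ≤ 1) {a : L} (ha : Polynomial.aeval a q = 0) :
    w a ≤ 1 := by
  have hT : (↑(q.map (algebraMap k L)).coeffs : Set L) ⊆ w.integer := by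
    intro c hc'
    obtain ⟨i, -, rfl⟩ := Polynomial.mem_coeffs_iff.1 hc'
    rw [Polynomial.coeff_map]
    exact hc i
  refine Valuation.Integers.mem_of_integral (Valuation.integer.integers w)
    ⟨(q.map (algebraMap k L)).toSubring _ hT, ?_, ?_⟩
  · rw [Polynomial.monic_toSubring]
    exact hq.map _
  · change Polynomial.eval₂ w.integer.subtype _ _ = 0
    rw [Polynomial.eval₂_eq_eval_map, Polynomial.map_toSubring, Polynomial.eval_map_algebraMap, ha]

section RelativelyAlgebraicallyClosed

variable {F : Type*} [NontriviallyNormedField F] [IsUltrametricDist F] [CompleteSpace F]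
  {k : Type*} [Field k] [Algebra k F] {Γ : Type*} [LinearOrderedCommGroupWithZero Γ]
  {v : Valuation k Γ}

section Embedding

variable {L : Type*} [Field L] [Algebra k L]
  (ι : L →ₐ[k] AlgebraicClosure F)

lemma exists_monic_integral_of_spectralValuation_le_one
    (hk : ∀ z : F, IsAlgebraic k z → z ∈ Set.range (algebraMap k F))
    (hv : ∀ c, v c ≤ 1 ↔ ‖algebraMap k F c‖ ≤ 1) {a : L} (ha : IsAlgebraic k a)
    (h : spectralValuation F (AlgebraicClosure F) (ι a) ≤ 1) :
    ∃ q : Polynomial k, q.Monic ∧ Polynomial.aeval a q = 0 ∧ ∀ i, v (q.coeff i) ≤ 1 := by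
  have hint : IsIntegral F (ι a) := Algebra.IsIntegral.isIntegral _
  have hmon := minpoly.monic hint
  -- The minimal polynomial over `F` divides the one over `k`, so its coefficients are integral over
  -- `k` and thus lie in `k`.
  have hmem : minpoly F (ι a) ∈ Polynomial.lifts (algebraMap k F) := by
    have := integralClosure.mem_lifts_of_monic_of_dvd_map F (minpoly.monic ha.isIntegral) hmon
      (minpoly.dvd _ _ (by
        rw [Polynomial.aeval_map_algebraMap, Polynomial.aeval_algHom_apply, minpoly.aeval,
          map_zero]))
    rw [Polynomial.lifts_iff_coeff_lifts] at this ⊢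
    intro n
    obtain ⟨c, hc⟩ := this n
    rw [← hc]
    exact hk _ (IsIntegral.isAlgebraic c.2)
  obtain ⟨q, hq, -, hqm⟩ := Polynomial.lifts_and_degree_eq_and_monic hmem hmon
  refine ⟨q, hqm, ?_, fun i ↦ ?_⟩
  · apply (ι : L →+* AlgebraicClosure F).injective
    rw [map_zero, RingHom.coe_coe, ← Polynomial.aeval_algHom_apply,
      ← Polynomial.aeval_map_algebraMap F, hq, minpoly.aeval]
  · rw [hv, ← Polynomial.coeff_map, hq]
    exact (spectralValue_le_one_iff hmon).1 h i

/-- Every extension of the valuation of a relatively algebraically closed subfield of a complete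
field to an algebraic extension is induced by the spectral norm. -/
lemma isEquiv_comap_spectralValuation [Algebra.IsAlgebraic k L]
    (hk : ∀ z : F, IsAlgebraic k z → z ∈ Set.range (algebraMap k F))
    (hv : ∀ c, v c ≤ 1 ↔ ‖algebraMap k F c‖ ≤ 1)
    (hnt : ∃ π : k, algebraMap k F π ≠ 0 ∧ ‖algebraMap k F π‖ < 1)
    {Γ' : Type*} [LinearOrderedCommGroupWithZero Γ'] (w : Valuation L Γ') (hw : v.HasExtension w) :
    w.IsEquiv ((spectralValuation F (AlgebraicClosure F)).comap (ι : L →+* AlgebraicClosure F)) := by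
  have key : ∀ a : L, spectralValuation F (AlgebraicClosure F) (ι a) ≤ 1 → w a ≤ 1 := by
    intro a ha
    obtain ⟨q, hqm, hqa, hqv⟩ := exists_monic_integral_of_spectralValuation_le_one ι hk hv
      (Algebra.IsAlgebraic.isAlgebraic a) ha
    exact valuation_le_one_of_aeval_eq_zero w hqm
      (fun i ↦ (Valuation.HasExtension.val_map_le_one_iff v w _).2 (hqv i)) hqa
  refine Valuation.isEquiv_of_val_le_one fun a ↦ ⟨fun h ↦ ?_, key a⟩
  by_contra! hlt
  rw [Valuation.comap_apply, RingHom.coe_coe] at hlt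
  obtain ⟨π, hπ0, hπ⟩ := hnt
  have hspec : spectralValuation F (AlgebraicClosure F) (ι (algebraMap k L π)) =
      ‖algebraMap k F π‖₊ := by
    rw [ι.commutes, IsScalarTower.algebraMap_apply k F, spectralValuation_algebraMap]
  have hπ0' : 0 < ‖algebraMap k F π‖₊ := by simpa using hπ0
  -- If `a` had spectral norm above 1 but `w a ≤ 1`, then for large `n` the inverse of `a ^ n * π`
  -- would have spectral norm at most 1, hence `w`-value at most 1. This contradicts `w (a ^ n * π)
  -- < 1`.
  obtain ⟨n, hn⟩ := exists_pow_lt_of_lt_one hπ0' (inv_lt_one_of_one_lt₀ hlt)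
  have hb := key ((a ^ n)⁻¹ * (algebraMap k L π)⁻¹) (by
    rw [map_mul, map_mul, map_inv₀, map_inv₀, map_inv₀, map_inv₀, hspec, map_pow, map_pow,
      ← inv_pow]
    calc _ ≤ ‖algebraMap k F π‖₊ * ‖algebraMap k F π‖₊⁻¹ := by gcongr
      _ = 1 := mul_inv_cancel₀ hπ0'.ne')
  have hwπ : w (algebraMap k L π) < 1 := by
    rw [Valuation.HasExtension.val_map_lt_one_iff v w]
    by_contra! hc
    have hne : π ≠ 0 := by rintro rfl; simp at hπ0
    have := (hv π⁻¹).1 (by rw [map_inv₀]; exact inv_le_one_of_one_le₀ hc)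
    rw [map_inv₀, norm_inv] at this
    exact absurd this (not_le.2 ((one_lt_inv₀ (by simpa using hπ0)).2 hπ))
  have hwπ0 : w (algebraMap k L π) ≠ 0 := by
    rw [Ne, Valuation.zero_iff]
    rintro h0
    rw [map_eq_zero] at h0
    simp [h0] at hπ0
  have ha0 : a ≠ 0 := by rintro rfl; simp at hlt
  have hwa : w a ≠ 0 := (Valuation.ne_zero_iff _).2 ha0
  rw [map_mul, map_inv₀, map_inv₀, map_pow, ← mul_inv,
    inv_le_one₀ (zero_lt_iff.2 (mul_ne_zero (pow_ne_zero _ hwa) hwπ0))] at hb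
  refine absurd hb (not_le.2 ?_)
  calc w a ^ n * w (algebraMap k L π) ≤ 1 * w (algebraMap k L π) := by
        gcongr; exact pow_le_one₀ zero_le h
    _ < 1 := by rwa [one_mul]

end Embedding

end RelativelyAlgebraicallyClosed

section Immediate

variable {K L Γ : Type*} [Field K] [Field L] [Algebra K L]
  [LinearOrderedCommGroupWithZero Γ] {w : Valuation L Γ}

lemma IsImmediate.exists_valuation_algebraMap_eq (h : IsImmediate K w) (a : L) :
    ∃ c : K, w (algebraMap K L c) = w a := by
  rcases eq_or_ne a 0 with rfl | ha
  · exact ⟨0, by simp⟩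
  have hwa : w a ≠ 0 := (Valuation.ne_zero_iff _).2 ha
  have hmem : Units.mk0 (w a) hwa ∈ baseValueGroup K w := by
    rw [h.1]
    exact MonoidWithZeroHom.mem_valueGroup _ ⟨a, rfl⟩
  obtain ⟨d, hd, e, he⟩ := (MonoidWithZeroHom.mem_valueGroup_iff_of_comm _).1 hmem
  change w (algebraMap K L d) ≠ 0 at hd
  change w (algebraMap K L d) * w a = w (algebraMap K L e) at he
  exact ⟨e / d, by rw [map_div₀, map_div₀, ← he, mul_div_cancel_left₀ _ hd]⟩

/-- Choose `c` with the value of `a`, then `d` with the residue of `a / c`; the product `c * d`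
cancels the leading term of `a`. -/
lemma IsImmediate.exists_valuation_sub_lt (h : IsImmediate K w) {a : L} (ha : a ≠ 0) :
    ∃ c : K, w (a - algebraMap K L c) < w a := by
  obtain ⟨c, hc⟩ := h.exists_valuation_algebraMap_eq a
  have hwa : w a ≠ 0 := (Valuation.ne_zero_iff _).2 ha
  have h1 : w (a / algebraMap K L c) = 1 := by rw [map_div₀, hc, div_self hwa]
  let u : w.valuationSubring := ⟨a / algebraMap K L c, h1.le⟩
  obtain ⟨r, hr⟩ := h.2 (IsLocalRing.residue _ u)
  obtain ⟨d, rfl⟩ := IsLocalRing.residue_surjective r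
  rw [Valuation.HasExtension.algebraMap_residue_eq_residue_algebraMap, eq_comm, ← sub_eq_zero,
    ← map_sub, IsLocalRing.residue_eq_zero_iff, Valuation.mem_maximalIdeal_iff] at hr
  change w (a / algebraMap K L c - algebraMap K L d) < 1 at hr
  have hc0 : algebraMap K L c ≠ 0 := by rw [← Valuation.ne_zero_iff w, hc]; exact hwa
  refine ⟨c * d, ?_⟩
  have : a - algebraMap K L (c * d) =
      (a / algebraMap K L c - algebraMap K L d) * algebraMap K L c := by
    rw [map_mul]; field_simp
  rw [this, map_mul, hc]
  exact mul_lt_of_lt_one_left (zero_lt_iff.2 hwa) hr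

end Immediate

section RelativelyAlgebraicallyClosed

variable {F : Type*} [NontriviallyNormedField F] [IsUltrametricDist F] [CompleteSpace F]
  {k : Type} [Field k] [Algebra k F] {Γ : Type*} [LinearOrderedCommGroupWithZero Γ]
  {v : Valuation k Γ}

theorem isHenselian_of_relativelyAlgebraicallyClosed
    (hk : ∀ z : F, IsAlgebraic k z → z ∈ Set.range (algebraMap k F))
    (hv : ∀ c, v c ≤ 1 ↔ ‖algebraMap k F c‖ ≤ 1)
    (hnt : ∃ π : k, algebraMap k F π ≠ 0 ∧ ‖algebraMap k F π‖ < 1) :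
    IsHenselian v := by
  intro L _ _ _
  let ι : L →ₐ[k] AlgebraicClosure F := IsAlgClosed.lift
  refine ⟨⟨ℝ≥0, inferInstance, (spectralValuation F (AlgebraicClosure F)).comap
    (ι : L →+* AlgebraicClosure F), ⟨Valuation.isEquiv_of_val_le_one fun c ↦ ?_⟩⟩,
    fun Γ₁ Γ₂ _ _ w₁ w₂ h₁ h₂ ↦ ?_⟩
  · rw [hv, Valuation.comap_apply, Valuation.comap_apply, RingHom.coe_coe, ι.commutes,
      IsScalarTower.algebraMap_apply k F (AlgebraicClosure F), spectralValuation_algebraMap]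
    rfl
  · exact (isEquiv_comap_spectralValuation ι hk hv hnt w₁ h₁).trans
      (isEquiv_comap_spectralValuation ι hk hv hnt w₂ h₂).symm

theorem isAlgebraicallyMaximal_of_relativelyAlgebraicallyClosed
    (hk : ∀ z : F, IsAlgebraic k z → z ∈ Set.range (algebraMap k F))
    (hv : ∀ c, v c ≤ 1 ↔ ‖algebraMap k F c‖ ≤ 1)
    (hnt : ∃ π : k, algebraMap k F π ≠ 0 ∧ ‖algebraMap k F π‖ < 1 ∧
      ∀ c, ‖algebraMap k F c‖ < 1 → ‖algebraMap k F c‖ ≤ ‖algebraMap k F π‖) :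
    IsAlgebraicallyMaximal v := by
  intro L _ _ _ Γ' _ w hw himm a
  obtain ⟨π, hπ0, hπ1, hπ⟩ := hnt
  let ι : L →ₐ[k] AlgebraicClosure F := IsAlgClosed.lift
  have hequiv := isEquiv_comap_spectralValuation ι hk hv ⟨π, hπ0, hπ1⟩ w hw
  set V := spectralValuation F (AlgebraicClosure F) with hV
  have hVk : ∀ c : k, V (ι (algebraMap k L c)) = ‖algebraMap k F c‖₊ := fun c ↦ by
    rw [ι.commutes, IsScalarTower.algebraMap_apply k F, spectralValuation_algebraMap]
  have hval : ∀ b : L, ∃ c : k, V (ι b) = ‖algebraMap k F c‖₊ := fun b ↦ by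
    obtain ⟨c, hc⟩ := himm.exists_valuation_algebraMap_eq b
    exact ⟨c, by rw [← hVk]; exact (hequiv.eq_iff.1 hc).symm⟩
  -- Each improvement strictly lowers a value taken on `k`, so by discreteness it gains at least a
  -- factor `‖π‖`.
  have happ : ∀ n : ℕ, ∃ c : k,
      V (ι (a - algebraMap k L c)) ≤ V (ι a) * ‖algebraMap k F π‖₊ ^ n := by
    intro n
    induction n with
    | zero => exact ⟨0, by simp⟩
    | succ n ih =>
      obtain ⟨c, hc⟩ := ih
      rcases eq_or_ne (a - algebraMap k L c) 0 with h0 | h0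
      · exact ⟨c, by simp [h0]⟩
      obtain ⟨d, hd⟩ := himm.exists_valuation_sub_lt h0
      replace hd : V (ι (a - algebraMap k L c - algebraMap k L d)) <
        V (ι (a - algebraMap k L c)) := hequiv.lt_iff_lt.1 hd
      refine ⟨c + d, ?_⟩
      rw [map_add, ← sub_sub, pow_succ, ← mul_assoc]
      refine le_trans ?_ (mul_le_mul_left hc _)
      obtain ⟨e₁, h₁⟩ := hval (a - algebraMap k L c)
      obtain ⟨e₂, h₂⟩ := hval (a - algebraMap k L c - algebraMap k L d)
      rw [h₁, h₂] at hd ⊢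
      have hpos : 0 < ‖algebraMap k F e₁‖₊ := pos_of_gt hd
      have := hπ (e₂ / e₁) (by
        rw [map_div₀, norm_div]
        exact (div_lt_one (by exact_mod_cast hpos)).2 hd)
      rw [map_div₀, norm_div, div_le_iff₀ (by exact_mod_cast hpos)] at this
      rw [mul_comm]
      exact this
  obtain ⟨z, hz⟩ := mem_range_of_forall_exists_spectralValuation_sub_lt (F := F) (ι a) (by
    intro ε hε
    rcases eq_or_ne a 0 with rfl | ha
    · exact ⟨0, by simpa using hε⟩
    have hpos : 0 < V (ι a) := by
      rw [zero_lt_iff, Valuation.ne_zero_iff]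
      simpa using ha
    obtain ⟨n, hn⟩ := exists_pow_lt_of_lt_one (div_pos hε hpos)
      (show ‖algebraMap k F π‖₊ < 1 from hπ1)
    obtain ⟨c, hc⟩ := happ n
    refine ⟨algebraMap k F c, ?_⟩
    rw [← IsScalarTower.algebraMap_apply, ← ι.commutes, ← map_sub]
    refine hc.trans_lt ?_
    rwa [mul_comm, ← lt_div_iff₀ hpos])
  have hzalg : IsAlgebraic k z := by
    rw [← isAlgebraic_algebraMap_iff (A := AlgebraicClosure F)
      (FaithfulSMul.algebraMap_injective F _), hz]
    exact (Algebra.IsAlgebraic.isAlgebraic a).algHom ι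
  obtain ⟨c, rfl⟩ := hk z hzalg
  refine ⟨c, (ι : L →+* AlgebraicClosure F).injective ?_⟩
  rw [RingHom.coe_coe, ι.commutes, ← hz, IsScalarTower.algebraMap_apply k F]

end RelativelyAlgebraicallyClosed

end ValuedField

/-! ### Degrees of p-th roots and p-independence -/

namespace PthRoots

open Polynomial

section Degree

variable {K L : Type*} [Field K] [Field L] [Algebra K L]

lemma eq_zero_of_sum_mul_pow_eq_zero {x : L} {n : ℕ} (hn : (minpoly K x).natDegree = n)
    {c : Fin n → K} (h : ∑ i, algebraMap K L (c i) * x ^ (i : ℕ) = 0) : c = 0 := by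
  subst hn
  funext i
  refine Fintype.linearIndependent_iff.1 (linearIndependent_pow (K := K) x) c ?_ i
  simpa only [Algebra.smul_def] using h

lemma exists_eq_sum_mul_pow {x z : L} (hx : IsIntegral K x) {n : ℕ}
    (hn : (minpoly K x).natDegree = n) (hz : z ∈ K⟮x⟯) :
    ∃ c : Fin n → K, z = ∑ i, algebraMap K L (c i) * x ^ (i : ℕ) := by
  obtain ⟨f, hf, hzf⟩ := (IntermediateField.adjoin.powerBasis hx).exists_eq_aeval ⟨z, hz⟩
  rw [IntermediateField.adjoin.powerBasis_dim, hn] at hf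
  refine ⟨fun i ↦ f.coeff i, ?_⟩
  have := congrArg (algebraMap K⟮x⟯ L) hzf
  rw [← Polynomial.aeval_algebraMap_apply, IntermediateField.adjoin.powerBasis_gen,
    IntermediateField.AdjoinSimple.algebraMap_gen, Polynomial.aeval_eq_sum_range' hf,
    Finset.sum_range] at this
  simp only [Algebra.smul_def] at this
  exact this

variable {p : ℕ} [hp : Fact p.Prime] {a : K} {x : L}

lemma minpoly_eq_X_pow_sub_C (ha : ∀ b, b ^ p ≠ a) (hx : x ^ p = algebraMap K L a) :
    minpoly K x = X ^ p - C a :=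
  (minpoly.eq_of_irreducible_of_monic (X_pow_sub_C_irreducible_of_prime hp.out ha)
    (by simp [hx]) (monic_X_pow_sub_C a hp.out.ne_zero)).symm

lemma natDegree_minpoly (ha : ∀ b, b ^ p ≠ a) (hx : x ^ p = algebraMap K L a) :
    (minpoly K x).natDegree = p := by
  rw [minpoly_eq_X_pow_sub_C ha hx, natDegree_X_pow_sub_C]

lemma isIntegral_of_pow_eq (hx : x ^ p = algebraMap K L a) : IsIntegral K x :=
  IsIntegral.of_pow hp.out.pos (hx ▸ isIntegral_algebraMap)

lemma finrank_adjoin (ha : ∀ b, b ^ p ≠ a) (hx : x ^ p = algebraMap K L a) :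
    Module.finrank K K⟮x⟯ = p := by
  rw [IntermediateField.adjoin.finrank (isIntegral_of_pow_eq hx), natDegree_minpoly ha hx]

end Degree

section Independence

variable {K : Type*} [Field K] (p : ℕ) [hp : Fact p.Prime] [CharP K p]

/-- Taking p-th roots turns the relation into `∑ c i * τ ^ i = 0`, where `τ` has degree `p`. -/
lemma eq_zero_of_sum_pow_mul_pow_eq_zero {t : K} (ht : ∀ b : K, b ^ p ≠ t) {c : Fin p → K}
    (h : ∑ i, c i ^ p * t ^ (i : ℕ) = 0) : c = 0 := by
  obtain ⟨τ, hτ⟩ := IsAlgClosed.exists_pow_nat_eq (algebraMap K (AlgebraicClosure K) t) hp.out.pos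
  have : CharP (AlgebraicClosure K) p := charP_of_injective_algebraMap' K p
  refine eq_zero_of_sum_mul_pow_eq_zero (natDegree_minpoly ht hτ) ?_
  rw [← pow_eq_zero_iff hp.out.ne_zero, sum_pow_char]
  simp_rw [mul_pow, ← pow_mul, mul_comm _ p, pow_mul, hτ, ← map_pow, ← map_mul, ← map_sum, h,
    map_zero]

variable {Ω : Type*} [Field Ω] [Algebra K Ω] {p} {t s : K} {τ σ : Ω}

/-- By Frobenius, the p-th power of `∑ c i * τ ^ i` is `∑ c i ^ p * t ^ i`. -/
lemma pow_ne_algebraMap_adjoin (ht : ∀ b, b ^ p ≠ t)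
    (hs : ∀ c : Fin p → K, ∑ i, c i ^ p * t ^ (i : ℕ) ≠ s) (hτ : τ ^ p = algebraMap K Ω t)
    (b : K⟮τ⟯) : b ^ p ≠ algebraMap K K⟮τ⟯ s := by
  intro h
  have : CharP Ω p := charP_of_injective_algebraMap' K p
  obtain ⟨c, hc⟩ := exists_eq_sum_mul_pow (isIntegral_of_pow_eq hτ) (natDegree_minpoly ht hτ) b.2
  refine hs c ((algebraMap K Ω).injective ?_)
  have h' : (b : Ω) ^ p = algebraMap K Ω s := congrArg (algebraMap K⟮τ⟯ Ω) h
  rw [← h', hc, sum_pow_char, map_sum]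
  refine Finset.sum_congr rfl fun i _ ↦ ?_
  rw [mul_pow, ← pow_mul, mul_comm (i : ℕ) p, pow_mul, hτ, map_mul, map_pow, map_pow]

lemma finrank_adjoin_adjoin (ht : ∀ b, b ^ p ≠ t)
    (hs : ∀ c : Fin p → K, ∑ i, c i ^ p * t ^ (i : ℕ) ≠ s) (hτ : τ ^ p = algebraMap K Ω t)
    (hσ : σ ^ p = algebraMap K Ω s) : Module.finrank K⟮τ⟯ (K⟮τ⟯)⟮σ⟯ = p :=
  finrank_adjoin (pow_ne_algebraMap_adjoin ht hs hτ)
    (by rw [hσ, ← IsScalarTower.algebraMap_apply])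

lemma finrank_adjoin_pair (ht : ∀ b, b ^ p ≠ t)
    (hs : ∀ c : Fin p → K, ∑ i, c i ^ p * t ^ (i : ℕ) ≠ s) (hτ : τ ^ p = algebraMap K Ω t)
    (hσ : σ ^ p = algebraMap K Ω s) : Module.finrank K K⟮τ, σ⟯ = p ^ 2 := by
  rw [← IntermediateField.adjoin_simple_adjoin_simple]
  change Module.finrank K (K⟮τ⟯)⟮σ⟯ = _
  rw [← Module.finrank_mul_finrank K K⟮τ⟯ (K⟮τ⟯)⟮σ⟯, finrank_adjoin ht hτ,
    finrank_adjoin_adjoin ht hs hτ hσ, sq]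

variable (p) in
-- After extraction of p-th roots this is the independence of the powers of `σ` over `K⟮τ⟯`,
-- followed by that of the powers of `τ` over `K`.
lemma eq_zero_of_sum_pow_mul_pow_mul_pow_eq_zero (ht : ∀ b : K, b ^ p ≠ t)
    (hs : ∀ c : Fin p → K, ∑ i, c i ^ p * t ^ (i : ℕ) ≠ s) {c : Fin p → Fin p → K}
    (h : ∑ j, ∑ i, c i j ^ p * t ^ (i : ℕ) * s ^ (j : ℕ) = 0) : c = 0 := by
  obtain ⟨τ, hτ⟩ := IsAlgClosed.exists_pow_nat_eq (algebraMap K (AlgebraicClosure K) t) hp.out.pos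
  obtain ⟨σ, hσ⟩ := IsAlgClosed.exists_pow_nat_eq (algebraMap K (AlgebraicClosure K) s) hp.out.pos
  have : CharP (AlgebraicClosure K) p := charP_of_injective_algebraMap' K p
  have hdeg := natDegree_minpoly (x := σ) (pow_ne_algebraMap_adjoin ht hs hτ)
    (by rw [hσ, ← IsScalarTower.algebraMap_apply])
  have key := eq_zero_of_sum_mul_pow_eq_zero hdeg
    (c := fun j ↦ ∑ i, algebraMap K K⟮τ⟯ (c i j) * IntermediateField.AdjoinSimple.gen K τ ^ (i : ℕ))
    (by
      rw [← pow_eq_zero_iff hp.out.ne_zero, sum_pow_char]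
      rw [← map_eq_zero (algebraMap K (AlgebraicClosure K))] at h
      rw [← h, map_sum]
      refine Finset.sum_congr rfl fun j _ ↦ ?_
      rw [← Finset.sum_mul, map_mul, mul_pow, ← pow_mul, mul_comm (j : ℕ) p, pow_mul, hσ, map_pow]
      congr 1
      rw [map_sum, map_sum, sum_pow_char]
      refine Finset.sum_congr rfl fun i _ ↦ ?_
      rw [map_mul, map_pow, IntermediateField.AdjoinSimple.algebraMap_gen,
        ← IsScalarTower.algebraMap_apply, mul_pow, ← pow_mul, mul_comm (i : ℕ) p, pow_mul, hτ,
        map_mul, map_pow, map_pow])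
  funext i j
  have := congrArg (algebraMap K⟮τ⟯ (AlgebraicClosure K)) (congrFun key j)
  refine congrFun (eq_zero_of_sum_mul_pow_eq_zero (c := fun i ↦ c i j)
    (natDegree_minpoly ht hτ) ?_) i
  rw [Pi.zero_apply, map_zero, map_sum] at this
  rw [← this]
  refine Finset.sum_congr rfl fun i _ ↦ ?_
  rw [map_mul, map_pow, IntermediateField.AdjoinSimple.algebraMap_gen,
        ← IsScalarTower.algebraMap_apply]

end Independence

/-! ### Separability from p-independence -/

section Span

variable {p : ℕ} [hp : Fact p.Prime] {F : Type*} [Field F] [Algebra (ZMod p) F] {t s : F}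

/-- The field `𝔽_p(t, s)` is spanned by the `t ^ i * s ^ j` with `i, j < p` over its subfield of
`p`-th powers. -/
lemma exists_eq_sum_pow_mul_pow_mul_pow {a : F} (ha : a ∈ (ZMod p)⟮t, s⟯) :
    ∃ c : Fin p → Fin p → F, (∀ i j, c i j ∈ (ZMod p)⟮t, s⟯) ∧
      a = ∑ j, ∑ i, c i j ^ p * t ^ (i : ℕ) * s ^ (j : ℕ) := by
  set M := (ZMod p)⟮t, s⟯ with hM
  have htM : t ∈ M := IntermediateField.subset_adjoin _ _ (by simp)
  have hsM : s ∈ M := IntermediateField.subset_adjoin _ _ (by simp)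
  have : CharP F p := charP_of_injective_algebraMap' (ZMod p) p
  let R (a : F) : Prop := ∃ c : Fin p → Fin p → F, (∀ i j, c i j ∈ M) ∧
      a = ∑ j, ∑ i, c i j ^ p * t ^ (i : ℕ) * s ^ (j : ℕ)
  have hadd : ∀ a b, R a → R b → R (a + b) := by
    rintro _ _ ⟨c, hc, rfl⟩ ⟨d, hd, rfl⟩
    refine ⟨c + d, fun i j ↦ add_mem (hc i j) (hd i j), ?_⟩
    simp_rw [← Finset.sum_add_distrib, Pi.add_apply, add_pow_char, add_mul]
  have hzero : R 0 := ⟨0, fun _ _ ↦ zero_mem _, by simp [hp.out.ne_zero]⟩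
  -- Exponents are reduced modulo `p`; the quotients are absorbed into the p-th power.
  have hgen : ∀ c ∈ M, ∀ i j : ℕ, R (c ^ p * t ^ i * s ^ j) := by
    intro c hc i j
    have hi := Nat.mod_lt i hp.out.pos
    have hj := Nat.mod_lt j hp.out.pos
    refine ⟨Pi.single ⟨i % p, hi⟩ (Pi.single ⟨j % p, hj⟩ (c * t ^ (i / p) * s ^ (j / p))),
      fun i' j' ↦ ?_, ?_⟩
    · simp only [Pi.single_apply]
      split_ifs
      · simp only [Pi.single_apply]
        split_ifs
        · exact mul_mem (mul_mem hc (pow_mem htM _)) (pow_mem hsM _)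
        · exact zero_mem _
      · exact zero_mem _
    · rw [Finset.sum_eq_single ⟨j % p, hj⟩, Finset.sum_eq_single ⟨i % p, hi⟩]
      · simp only [Pi.single_eq_same]
        nth_rw 1 [← Nat.div_add_mod i p, ← Nat.div_add_mod j p]
        ring
      · intro i' _ h
        simp [Pi.single_eq_of_ne h, hp.out.ne_zero]
      · simp
      · intro j' _ h
        refine Finset.sum_eq_zero fun i' _ ↦ ?_
        rcases eq_or_ne i' ⟨i % p, hi⟩ with rfl | h'
        · simp [Pi.single_eq_of_ne h, hp.out.ne_zero]
        · simp [Pi.single_eq_of_ne h', hp.out.ne_zero]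
      · simp
  have hsum : ∀ f : Fin p → Fin p → F, (∀ i j, R (f i j)) → R (∑ j, ∑ i, f i j) := fun f hf ↦
    Finset.sum_induction _ R hadd hzero fun j _ ↦
      Finset.sum_induction _ R hadd hzero fun i _ ↦ hf i j
  have hmul : ∀ a ∈ Algebra.adjoin (ZMod p) {t, s}, ∀ d, R d → R (a * d) := by
    intro a ha
    induction ha using Algebra.adjoin_induction with
    | mem a ha =>
      rintro _ ⟨c, hc, rfl⟩
      simp_rw [Finset.mul_sum]
      refine hsum _ fun i j ↦ ?_
      rcases ha with rfl | ha
      · convert hgen _ (hc i j) (i + 1) j using 1; ring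
      · rw [Set.mem_singleton_iff] at ha
        convert hgen _ (hc i j) i (j + 1) using 1; rw [ha]; ring
    | algebraMap r =>
      rintro _ ⟨c, hc, rfl⟩
      simp_rw [Finset.mul_sum]
      refine hsum _ fun i j ↦ ?_
      convert hgen _ (mul_mem (M.algebraMap_mem r) (hc i j)) i j using 1
      rw [mul_pow, ← map_pow, ZMod.pow_card]
      ring
    | add a b _ _ iha ihb =>
      intro d hd
      rw [add_mul]
      exact hadd _ _ (iha d hd) (ihb d hd)
    | mul a b _ _ iha ihb =>
      intro d hd
      rw [mul_assoc]
      exact iha _ (ihb d hd)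
  obtain ⟨r, hr, q, hq, rfl⟩ := IntermediateField.mem_adjoin_iff_div.1 ha
  rcases eq_or_ne q 0 with rfl | hq0
  · simpa using hzero
  have hqM : q ∈ M := IntermediateField.algebra_adjoin_le_adjoin _ _ hq
  -- Denominators go into the p-th power: r / q = (r q^(p-1)) (1/q)^p.
  have := hmul _ (mul_mem hr (pow_mem hq (p - 1))) _ (hgen _ (inv_mem hqM) 0 0)
  have e : r / q = r * q ^ (p - 1) * (q⁻¹ ^ p * t ^ 0 * s ^ 0) := by
    obtain ⟨n, hn⟩ : ∃ n, p = n + 1 := ⟨p - 1, (Nat.succ_pred_eq_of_pos hp.out.pos).symm⟩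
    rw [hn, Nat.add_sub_cancel, inv_pow]
    field_simp
    ring
  rw [e]
  exact this

/-- If the `t ^ i * s ^ j` with `i, j < p` stay independent over the `p`-th powers of a finite
extension `K(a)` of `K = 𝔽_p(t, s)`, then `a` is separable over `K`. -/
lemma isSeparable_of_independent {a : F} (ha : IsIntegral (ZMod p)⟮t, s⟯ a)
    (hind : ∀ c : Fin p → Fin p → F, (∀ i j, c i j ∈ ((ZMod p)⟮t, s⟯)⟮a⟯) →
      ∑ j, ∑ i, c i j ^ p * t ^ (i : ℕ) * s ^ (j : ℕ) = 0 → c = 0) :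
    IsSeparable (ZMod p)⟮t, s⟯ a := by
  set M := (ZMod p)⟮t, s⟯ with hM
  have : CharP F p := charP_of_injective_algebraMap' (ZMod p) p
  have : CharP M p := charP_of_injective_algebraMap' (ZMod p) p
  refine (separable_or p (minpoly.irreducible ha)).resolve_right ?_
  rintro ⟨-, g, hg, hgf⟩
  -- If `a` is inseparable, its minimal polynomial is g(X^p). Splitting the coefficients of `g`
  -- along the t^i s^j gives ∑ h_ij(a)^p t^i s^j = 0. Independence yields h_ij(a) = 0 with deg h_ij
  -- below the degree of `a`, so all h_ij vanish, and with them `g`.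
  choose c hcM hc using fun n ↦ exists_eq_sum_pow_mul_pow_mul_pow (g.coeff n).2
  let h (i j : Fin p) : M[X] := ∑ n ∈ Finset.range (g.natDegree + 1), C ⟨c n i j, hcM n i j⟩ * X ^ n
  have hh : ∀ i j, aeval a (h i j) = ∑ n ∈ Finset.range (g.natDegree + 1), c n i j * a ^ n := by
    intro i j
    simp only [h, map_sum, map_mul, aeval_C, map_pow, aeval_X]
    rfl
  have hzero := hind (fun i j ↦ aeval a (h i j))
    (fun i j ↦ IntermediateField.algebra_adjoin_le_adjoin _ _
      (Polynomial.aeval_mem_adjoin_singleton M a)) (by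
    have h0 := minpoly.aeval M a
    rw [← hgf, expand_aeval, aeval_eq_sum_range] at h0
    rw [← h0]
    simp_rw [hh, sum_pow_char, Finset.sum_mul]
    have : ∀ j : Fin p, ∑ i : Fin p, ∑ n ∈ Finset.range (g.natDegree + 1),
        (c n i j * a ^ n) ^ p * t ^ (i : ℕ) * s ^ (j : ℕ) =
        ∑ n ∈ Finset.range (g.natDegree + 1), ∑ i : Fin p,
        (c n i j * a ^ n) ^ p * t ^ (i : ℕ) * s ^ (j : ℕ) := fun j ↦ Finset.sum_comm
    simp_rw [this]
    rw [Finset.sum_comm]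
    refine Finset.sum_congr rfl fun n _ ↦ ?_
    rw [Algebra.smul_def, IntermediateField.algebraMap_apply, hc n, Finset.sum_mul]
    refine Finset.sum_congr rfl fun j _ ↦ ?_
    rw [Finset.sum_mul]
    exact Finset.sum_congr rfl fun i _ ↦ by ring)
  have hdeg : g.natDegree < (minpoly M a).natDegree := by
    rw [← hgf, natDegree_expand]
    exact lt_mul_of_one_lt_right hg.natDegree_pos hp.out.one_lt
  have hcoeff : ∀ i j, h i j = 0 := by
    intro i j
    refine eq_zero_of_dvd_of_natDegree_lt (minpoly.dvd M a (congrFun (congrFun hzero i) j))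
      (lt_of_le_of_lt (natDegree_sum_le_of_forall_le _ _ fun n hn ↦ ?_) hdeg)
    exact (natDegree_C_mul_X_pow_le _ _).trans (Nat.lt_succ_iff.1 (Finset.mem_range.1 hn))
  refine hg.ne_zero (Polynomial.ext fun n ↦ ?_)
  rw [coeff_zero]
  rcases lt_or_ge g.natDegree n with hn | hn
  · exact coeff_eq_zero_of_natDegree_lt hn
  refine Subtype.ext ?_
  rw [hc n]
  refine Finset.sum_eq_zero fun j _ ↦ Finset.sum_eq_zero fun i _ ↦ ?_
  have := congrArg (fun q ↦ ((q.coeff n : M) : F)) (hcoeff i j)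
  simp only [h, finsetSum_coeff, coeff_C_mul, coeff_X_pow, mul_ite, mul_one, mul_zero,
    Finset.sum_ite_eq, Finset.mem_range, Nat.lt_succ_of_le hn, if_true, coeff_zero] at this
  rw [this]
  simp [hp.out.ne_zero]

end Span

/-! ### Transcendence degree -/

section Transcendence

variable {k F : Type} [Field k] [Field F] [Algebra k F]

/-- With at most one element in a transcendence basis, `F` would be algebraic over a countable
field, hence countable. -/
lemma exists_algebraicIndependent_pair_of_countable (hk : Cardinal.mk k ≤ Cardinal.aleph0)
    (hF : Cardinal.aleph0 < Cardinal.mk F) : ∃ x y : F, AlgebraicIndependent k ![x, y] := by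
  obtain ⟨ι, b, hb⟩ := exists_isTranscendenceBasis' k F
  rcases subsingleton_or_nontrivial ι with hι | ⟨i, j, hij⟩
  · have hk' : Cardinal.mk (IntermediateField.adjoin k (Set.range b)) ≤ Cardinal.aleph0 := by
      refine (IntermediateField.cardinalMk_adjoin_le _ _).trans ?_
      have : Countable (Set.range b) := Set.countable_range b |>.to_subtype
      simp [hk]
    have := hb.isAlgebraic_field
    have h := Algebra.IsAlgebraic.cardinalMk_le_max (IntermediateField.adjoin k (Set.range b)) F
    exact absurd hF (not_lt.2 (h.trans (max_le hk' le_rfl)))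
  · refine ⟨b i, b j, ?_⟩
    have := hb.1.comp ![i, j] (by
      intro a b h
      fin_cases a <;> fin_cases b <;> simp_all [Ne.symm hij])
    convert this using 1
    ext a
    fin_cases a <;> rfl

/-- In the matroid of algebraic independence, the closure of `{s}` has rank at most 1 and cannot
contain an independent pair. -/
lemma not_isAlgebraic_of_algebraicIndependent {x y s : F} (h : AlgebraicIndependent k ![x, y]) :
    ¬ (IsAlgebraic k⟮s⟯ x ∧ IsAlgebraic k⟮s⟯ y) := by
  rintro ⟨hx, hy⟩
  have hmem : ∀ z : F, IsAlgebraic k⟮s⟯ z →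
      z ∈ (AlgebraicIndependent.matroid k F).closure {s} := by
    intro z hz
    rw [AlgebraicIndependent.matroid_closure_eq]
    exact (Subalgebra.mem_algebraicClosure _ _).2 (IntermediateField.isAlgebraic_adjoin_iff.1 hz)
  have hcard := (AlgebraicIndependent.matroid_indep_iff.2
    h.to_subtype_range).encard_le_eRk_of_subset
    (X := (AlgebraicIndependent.matroid k F).closure {s}) (by
      rintro _ ⟨i, rfl⟩
      fin_cases i
      exacts [hmem _ hx, hmem _ hy])
  rw [Matroid.eRk_closure_eq] at hcard
  have := hcard.trans (Matroid.eRk_le_encard _ _)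
  rw [← Set.image_univ, h.injective.encard_image, Set.encard_singleton, Set.encard_univ] at this
  simp at this

lemma isAlgebraic_adjoin_adjoin {t s z : F} (hz : IsAlgebraic k⟮t, s⟯ z) :
    IsAlgebraic (k⟮t⟯)⟮s⟯ z := by
  have hle : ∀ z ∈ k⟮t, s⟯, z ∈ (k⟮t⟯)⟮s⟯ := by
    rw [← IntermediateField.adjoin_simple_adjoin_simple]
    exact fun _ h ↦ h
  let : Algebra k⟮t, s⟯ (k⟮t⟯)⟮s⟯ := (Subring.inclusion (S := k⟮t, s⟯.toSubring)
    (T := (k⟮t⟯)⟮s⟯.toSubring) hle).toAlgebra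
  have : IsScalarTower k⟮t, s⟯ (k⟮t⟯)⟮s⟯ F := IsScalarTower.of_algebraMap_eq fun _ ↦ rfl
  exact hz.extendScalars (Subring.inclusion_injective hle)

end Transcendence

end PthRoots

/-! ### p-th roots of `t` and `s` generate all p-th roots of `L₀` -/

namespace DelonExample

variable (p : ℕ) [hp : Fact p.Prime]

instance : CharP (ZMod p)⸨X⸩ p :=
  charP_of_injective_ringHom (algebraMap (ZMod p) (ZMod p)⸨X⸩).injective p

lemma valuation_tSeries :
    (Valued.v : Valuation (ZMod p)⸨X⸩ (WithZero (Multiplicative ℤ))) (tSeries p) =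
      WithZero.exp (-1) :=
  LaurentSeries.valuation_single_zpow (ZMod p) 1

lemma pow_ne_tSeries (b : (ZMod p)⸨X⸩) : b ^ p ≠ tSeries p := by
  intro h
  have h1 := congrArg (Valued.v : Valuation (ZMod p)⸨X⸩ (WithZero (Multiplicative ℤ))) h
  rw [map_pow, valuation_tSeries] at h1
  have h2 := congrArg WithZero.log h1
  rw [WithZero.log_pow, WithZero.log_exp, nsmul_eq_mul] at h2
  have : (p : ℤ) ∣ 1 := ⟨-WithZero.log (Valued.v b), by linarith⟩
  have := Int.le_of_dvd one_pos this
  have := hp.out.one_lt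
  omega

lemma aleph0_lt_cardinalMk_laurentSeries : Cardinal.aleph0 < Cardinal.mk (ZMod p)⸨X⸩ := by
  classical
  have : Function.Injective fun S : Set ℕ ↦
      HahnSeries.ofPowerSeries ℤ (ZMod p) (PowerSeries.mk fun n ↦ if n ∈ S then 1 else 0) := by
    intro S T h
    ext n
    have := congrArg (PowerSeries.coeff n) (HahnSeries.ofPowerSeries_injective h)
    rw [PowerSeries.coeff_mk, PowerSeries.coeff_mk] at this
    by_cases h1 : n ∈ S <;> by_cases h2 : n ∈ T <;> simp_all
  refine lt_of_lt_of_le ?_ (Cardinal.mk_le_of_injective this)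
  rw [Cardinal.mk_set, Cardinal.mk_nat]
  exact Cardinal.cantor _

lemma exists_algebraicIndependent_pair :
    ∃ x y : (ZMod p)⸨X⸩, AlgebraicIndependent (RatSubfield p) ![x, y] := by
  refine PthRoots.exists_algebraicIndependent_pair_of_countable
    ((IntermediateField.cardinalMk_adjoin_le _ _).trans ?_) (aleph0_lt_cardinalMk_laurentSeries p)
  simp

variable {p} {x y : (ZMod p)⸨X⸩}

lemma mem_L₀_iff {z : (ZMod p)⸨X⸩} : z ∈ L₀ p x y ↔ IsAlgebraic (BaseField p x y) z :=
  mem_algebraicClosure_iff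

lemma not_mem_L₀ (h : AlgebraicIndependent (RatSubfield p) ![x, y]) :
    ¬ (x ∈ L₀ p x y ∧ y ∈ L₀ p x y) := fun hxy ↦
  PthRoots.not_isAlgebraic_of_algebraicIndependent h
    ⟨PthRoots.isAlgebraic_adjoin_adjoin (mem_L₀_iff.1 hxy.1),
      PthRoots.isAlgebraic_adjoin_adjoin (mem_L₀_iff.1 hxy.2)⟩

/-- `s` does not lie in `L₀ ^ p (t)`. -/
lemma sum_pow_mul_pow_ne_s (h : AlgebraicIndependent (RatSubfield p) ![x, y])
    (c : Fin p → L₀ p x y) : ∑ i, c i ^ p * t p x y ^ (i : ℕ) ≠ s p x y := by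
  intro hs
  have hs' := congrArg (L₀ p x y).subtype hs
  rw [map_sum] at hs'
  have h01 : (⟨1, hp.out.one_lt⟩ : Fin p) ≠ ⟨0, hp.out.pos⟩ := by simp
  -- The coefficients of `s` over the p-th powers of `𝔽_p((t))` are unique: `x` at index 0, `y` at
  -- index 1, and 0 elsewhere.
  have := PthRoots.eq_zero_of_sum_pow_mul_pow_eq_zero p (pow_ne_tSeries p)
    (c := fun i ↦ (c i : (ZMod p)⸨X⸩) - (Pi.single (M := fun _ ↦ (ZMod p)⸨X⸩) ⟨0, hp.out.pos⟩ x +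
      Pi.single (M := fun _ ↦ (ZMod p)⸨X⸩) ⟨1, hp.out.one_lt⟩ y : Fin p → (ZMod p)⸨X⸩) i) (by
    simp_rw [sub_pow_char, sub_mul, Finset.sum_sub_distrib, Pi.add_apply, add_pow_char, add_mul,
      Finset.sum_add_distrib]
    rw [sub_eq_zero]
    trans x ^ p + tSeries p * y ^ p
    · exact hs'
    · symm
      rw [Finset.sum_eq_single ⟨0, hp.out.pos⟩, Finset.sum_eq_single ⟨1, hp.out.one_lt⟩]
      · simp [mul_comm]
      · intro i _ hi
        rw [Pi.single_eq_of_ne hi, zero_pow hp.out.ne_zero, zero_mul]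
      · simp
      · intro i _ hi
        rw [Pi.single_eq_of_ne hi, zero_pow hp.out.ne_zero, zero_mul]
      · simp)
  have h0 := sub_eq_zero.1 (congrFun this ⟨0, hp.out.pos⟩)
  have h1 := sub_eq_zero.1 (congrFun this ⟨1, hp.out.one_lt⟩)
  rw [Pi.add_apply, Pi.single_eq_same, Pi.single_eq_of_ne h01.symm, add_zero] at h0
  rw [Pi.add_apply, Pi.single_eq_same, Pi.single_eq_of_ne h01, zero_add] at h1
  exact not_mem_L₀ h ⟨Eq.mp (congrArg (· ∈ L₀ p x y) h0) (c _).2,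
    Eq.mp (congrArg (· ∈ L₀ p x y) h1) (c _).2⟩

lemma pow_ne_t (b : L₀ p x y) : b ^ p ≠ t p x y := fun h ↦
  pow_ne_tSeries p b.1 (congrArg (L₀ p x y).subtype h)

lemma isSeparable_of_mem_L₀ (h : AlgebraicIndependent (RatSubfield p) ![x, y]) {a : (ZMod p)⸨X⸩}
    (ha : a ∈ L₀ p x y) : IsSeparable (BaseField p x y) a := by
  have ha' : IsIntegral (BaseField p x y) a := (mem_L₀_iff.1 ha).isIntegral
  refine PthRoots.isSeparable_of_independent ha' fun c hc h0 ↦ ?_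
  have hle : (BaseField p x y)⟮a⟯ ≤ algebraicClosure (BaseField p x y) (ZMod p)⸨X⸩ := by
    rw [IntermediateField.adjoin_simple_le_iff]
    exact ha
  have := PthRoots.eq_zero_of_sum_pow_mul_pow_mul_pow_eq_zero (K := L₀ p x y) p pow_ne_t
    (sum_pow_mul_pow_ne_s h) (c := fun i j ↦ ⟨c i j, hle (hc i j)⟩) (by
      refine Subtype.ext ?_
      rw [← Subfield.coe_subtype, map_sum]
      simp_rw [map_sum]
      exact h0)
  funext i j
  exact congrArg Subtype.val (congrFun (congrFun this i) j)

/-- All elements of `L₀` are `p`-th powers in `L₀(τ, σ)`. -/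
lemma exists_pow_eq_algebraMap (h : AlgebraicIndependent (RatSubfield p) ![x, y])
    {Ω : Type*} [Field Ω] [Algebra (L₀ p x y) Ω] {τ σ : Ω}
    (hτ : τ ^ p = algebraMap (L₀ p x y) Ω (t p x y))
    (hσ : σ ^ p = algebraMap (L₀ p x y) Ω (s p x y)) (a : L₀ p x y) :
    ∃ e ∈ (L₀ p x y)⟮τ, σ⟯, e ^ p = algebraMap (L₀ p x y) Ω a := by
  have : CharP Ω p := charP_of_injective_algebraMap' (L₀ p x y) p
  -- `T` consists of the elements of `L₀` that are p-th powers in `L₀(τ, σ)`. It is a field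
  -- containing `BaseField` and all p-th powers of `L₀`.
  let T : Subfield (ZMod p)⸨X⸩ := (((L₀ p x y)⟮τ, σ⟯.toSubfield.map (frobenius Ω p)).comap
    (algebraMap (L₀ p x y) Ω)).map (L₀ p x y).subtype
  have hmem : ∀ b : L₀ p x y, (b : (ZMod p)⸨X⸩) ∈ T ↔
      ∃ e ∈ (L₀ p x y)⟮τ, σ⟯, e ^ p = algebraMap (L₀ p x y) Ω b := by
    intro b
    constructor
    · rintro ⟨b', ⟨e, he, hb'⟩, hb⟩
      obtain rfl : b' = b := Subtype.ext hb
      exact ⟨e, he, hb'⟩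
    · rintro ⟨e, he, hb⟩
      exact ⟨b, ⟨e, he, hb⟩, rfl⟩
  have hbase : ∀ b ∈ BaseField p x y, b ∈ T := by
    intro b hb
    induction hb using IntermediateField.adjoin_induction with
    | mem b hb =>
      rcases hb with rfl | rfl
      · exact (hmem (t p x y)).2 ⟨τ, IntermediateField.subset_adjoin _ _ (by simp), hτ⟩
      · exact (hmem (s p x y)).2 ⟨σ, IntermediateField.subset_adjoin _ _ (by simp), hσ⟩
    | algebraMap r =>
      refine (hmem ⟨_, mem_L₀ p x y (IntermediateField.algebraMap_mem _ r)⟩).2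
        ⟨_, IntermediateField.algebraMap_mem _
          ⟨_, mem_L₀ p x y (IntermediateField.algebraMap_mem _ r)⟩, ?_⟩
      rw [← map_pow]
      congr 1
      refine Subtype.ext ?_
      change (algebraMap (ZMod p) (ZMod p)⸨X⸩ r) ^ p = _
      rw [← map_pow, ZMod.pow_card]
    | add a b _ _ iha ihb => exact add_mem iha ihb
    | inv a _ iha => exact inv_mem iha
    | mul a b _ _ iha ihb => exact mul_mem iha ihb
  refine (hmem a).1 ?_
  have : ExpChar (BaseField p x y) p :=
    have : CharP (BaseField p x y) p :=
      charP_of_injective_ringHom (algebraMap (ZMod p) (BaseField p x y)).injective p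
    inferInstance
  have hap : (a : (ZMod p)⸨X⸩) ^ p ∈ T :=
    (hmem (a ^ p)).2 ⟨_, IntermediateField.algebraMap_mem _ a, (map_pow _ _ _).symm⟩
  -- Separability of `a` enters here: `a` lies in the field generated by `a ^ p`, whose generator is
  -- already in `T`.
  have ha : (a : (ZMod p)⸨X⸩) ∈ (BaseField p x y)⟮(a : (ZMod p)⸨X⸩) ^ p⟯ := by
    rw [← IntermediateField.adjoin_simple_eq_adjoin_pow_expChar_of_isSeparable _ _
      (isSeparable_of_mem_L₀ h a.2) p]
    exact IntermediateField.mem_adjoin_simple_self _ _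
  generalize (a : (ZMod p)⸨X⸩) ^ p = b at ha hap
  generalize (a : (ZMod p)⸨X⸩) = c at ha ⊢
  induction ha using IntermediateField.adjoin_induction with
  | mem b hb =>
    obtain rfl := Set.mem_singleton_iff.1 hb
    exact hap
  | algebraMap r => exact hbase _ r.2
  | add a b _ _ iha ihb => exact add_mem iha ihb
  | inv a _ iha => exact inv_mem iha
  | mul a b _ _ iha ihb => exact mul_mem iha ihb

end DelonExample

/-! ### Cyclic value groups and prime residue fields -/

namespace ValuedField

open MonoidWithZeroHom

lemma mem_valueGroup_iff {K Γ : Type*} [Field K] [LinearOrderedCommGroupWithZero Γ]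
    (v : Valuation K Γ) (g : Γˣ) : g ∈ valueGroup (.ofClass v) ↔ ∃ a, v a = g := by
  refine ⟨fun h ↦ ?_, fun ⟨a, ha⟩ ↦ mem_valueGroup _ ⟨a, ha⟩⟩
  obtain ⟨a, ha, b, hb⟩ := (mem_valueGroup_iff_of_comm _).1 h
  change v a ≠ 0 at ha
  change v a * g = v b at hb
  exact ⟨b / a, by rw [map_div₀, ← hb, mul_div_cancel_left₀ _ ha]⟩

lemma valueGroup_eq_zpowers {K Γ : Type*} [Field K] [LinearOrderedCommGroupWithZero Γ]
    (v : Valuation K Γ) {g : Γˣ} {n : K} (hn : v n = g) (h : ∀ a ≠ 0, ∃ k : ℤ, v a = v n ^ k) :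
    valueGroup (.ofClass v) = Subgroup.zpowers g := by
  ext u
  rw [mem_valueGroup_iff, Subgroup.mem_zpowers_iff]
  constructor
  · rintro ⟨a, ha⟩
    have ha0 : a ≠ 0 := by
      rintro rfl
      rw [map_zero] at ha
      exact u.ne_zero ha.symm
    obtain ⟨k, hk⟩ := h a ha0
    exact ⟨k, Units.ext (by rw [← ha, hk, hn, Units.val_zpow_eq_zpow_val])⟩
  · rintro ⟨k, rfl⟩
    exact ⟨n ^ k, by rw [map_zpow₀, hn, Units.val_zpow_eq_zpow_val]⟩

/-- The hypothesis says that the residue field of `w` is its prime field. -/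
lemma surjective_algebraMap_residueField {K L Γ : Type*} [Field K] [Field L] [Algebra K L]
    [LinearOrderedCommGroupWithZero Γ] (w : Valuation L Γ)
    (h : ∀ u, w u ≤ 1 → ∃ k : ℕ, w (u - k) < 1) :
    Function.Surjective
      (algebraMap (IsLocalRing.ResidueField (w.comap (algebraMap K L)).valuationSubring)
        (IsLocalRing.ResidueField w.valuationSubring)) := by
  intro r
  obtain ⟨u, rfl⟩ := IsLocalRing.residue_surjective r
  obtain ⟨k, hk⟩ := h u u.2
  refine ⟨k, ?_⟩
  rw [map_natCast, ← map_natCast (IsLocalRing.residue _), eq_comm, ← sub_eq_zero, ← map_sub,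
    IsLocalRing.residue_eq_zero_iff, Valuation.mem_maximalIdeal_iff]
  exact hk

lemma residueDegree_eq_one {K L Γ : Type*} [Field K] [Field L] [Algebra K L]
    [LinearOrderedCommGroupWithZero Γ] (w : Valuation L Γ)
    (h : ∀ u, w u ≤ 1 → ∃ k : ℕ, w (u - k) < 1) : residueDegree K w = 1 := by
  refine (finrank_eq_one_iff_of_nonzero' 1 one_ne_zero).2 fun r ↦ ?_
  obtain ⟨c, hc⟩ := surjective_algebraMap_residueField (K := K) w h r
  exact ⟨c, by rw [← Algebra.algebraMap_eq_smul_one, hc]⟩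

lemma relIndex_zpowers_pow {G : Type*} [Group G] (g : G) (hg : ¬ IsOfFinOrder g) (n : ℕ) :
    (Subgroup.zpowers (g ^ n)).relIndex (Subgroup.zpowers g) = n := by
  have hinj : Function.Injective (zpowersHom G g) := by
    intro a b h
    exact injective_zpow_iff_not_isOfFinOrder.2 hg h
  have h1 : Subgroup.zpowers g = Subgroup.map (zpowersHom G g) ⊤ := by
    rw [← MonoidHom.range_eq_map]
    rfl
  have h2 : Subgroup.zpowers (g ^ n) =
      Subgroup.map (zpowersHom G g) (Subgroup.zpowers (Multiplicative.ofAdd (n : ℤ))) := by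
    rw [MonoidHom.map_zpowers]
    simp
  rw [h1, h2, Subgroup.relIndex_map_map_of_injective _ _ hinj, Subgroup.relIndex_top_right]
  change (AddSubgroup.toSubgroup (AddSubgroup.zmultiples (n : ℤ))).index = n
  rw [AddSubgroup.index_toSubgroup, Int.index_zmultiples, Int.natAbs_natCast]

lemma isRankOneDiscrete_of_eq_exp {K : Type*} [Field K]
    {v : Valuation K (WithZero (Multiplicative ℤ))} {π : K} (h : v π = WithZero.exp (-1)) :
    v.IsRankOneDiscrete := by
  have hπ : v π ≠ 0 := by rw [h]; exact WithZero.exp_ne_zero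
  refine ⟨Units.mk0 (v π) hπ, (valueGroup_eq_zpowers v (n := π) rfl fun a ha ↦
    ⟨-WithZero.log (v a), ?_⟩).symm, ?_⟩
  · rw [h, ← WithZero.exp_zsmul, ← WithZero.exp_log ((Valuation.ne_zero_iff v).2 ha)]
    simp
  · rw [← Units.val_lt_val, Units.val_mk0, h, Units.val_one, ← WithZero.exp_zero,
      WithZero.exp_lt_exp]
    simp

end ValuedField

/-! ### The valuation of `L₀` -/

namespace DelonExample

open ValuedField MonoidWithZeroHom

variable {p : ℕ} [hp : Fact p.Prime] {x y : (ZMod p)⸨X⸩}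

local notation "vF" => (Valued.v : Valuation (ZMod p)⸨X⸩ (WithZero (Multiplicative ℤ)))

lemma v₀_apply (a : L₀ p x y) : v₀ p x y a = vF a := rfl

lemma v₀_t : v₀ p x y (t p x y) = WithZero.exp (-1) := valuation_tSeries p

lemma charP_L₀ : CharP (L₀ p x y) p :=
  (RingHom.charP_iff (L₀ p x y).subtype (L₀ p x y).subtype.injective p).2 inferInstance

lemma isRankOneDiscrete_v₀ : (v₀ p x y).IsRankOneDiscrete := isRankOneDiscrete_of_eq_exp v₀_t

lemma isAlgebraic_L₀ (z : (ZMod p)⸨X⸩) (hz : IsAlgebraic (L₀ p x y) z) :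
    z ∈ Set.range (algebraMap (L₀ p x y) (ZMod p)⸨X⸩) := by
  have hz' : IsAlgebraic (algebraicClosure (BaseField p x y) (ZMod p)⸨X⸩) z := hz
  have := hz'.restrictScalars (BaseField p x y)
  exact ⟨⟨z, mem_L₀_iff.2 this⟩, rfl⟩

lemma isHenselian_and_isAlgebraicallyMaximal_v₀ :
    IsHenselian (v₀ p x y) ∧ IsAlgebraicallyMaximal (v₀ p x y) := by
  have : (vF).IsRankOneDiscrete := isRankOneDiscrete_of_eq_exp (valuation_tSeries p)
  -- The base 2 of the norm is an arbitrary choice.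
  let : (vF).RankOne := Valuation.IsRankOneDiscrete.rankOne vF one_lt_two
  let : NontriviallyNormedField (ZMod p)⸨X⸩ :=
    Valued.toNontriviallyNormedField _ (WithZero (Multiplicative ℤ))
  have : CompleteSpace (ZMod p)⸨X⸩ := LaurentSeries.instLaurentSeriesComplete
  have : IsUltrametricDist (ZMod p)⸨X⸩ :=
    Valued.instIsUltrametricDist _ (WithZero (Multiplicative ℤ))
  have hv (c : L₀ p x y) : v₀ p x y c ≤ 1 ↔ ‖algebraMap (L₀ p x y) (ZMod p)⸨X⸩ c‖ ≤ 1 :=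
    (Valued.toNormedField.norm_le_one_iff (L := (ZMod p)⸨X⸩) (x := c.1)).symm
  have ht0 : algebraMap (L₀ p x y) (ZMod p)⸨X⸩ (t p x y) ≠ 0 := by
    change tSeries p ≠ 0
    rw [← Valuation.ne_zero_iff vF, valuation_tSeries]
    exact WithZero.exp_ne_zero
  have ht1 : ‖algebraMap (L₀ p x y) (ZMod p)⸨X⸩ (t p x y)‖ < 1 := by
    refine Valued.toNormedField.norm_lt_one_iff.2 ?_
    change vF (tSeries p) < 1
    rw [valuation_tSeries, ← WithZero.exp_zero, WithZero.exp_lt_exp]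
    simp
  refine ⟨isHenselian_of_relativelyAlgebraicallyClosed isAlgebraic_L₀ hv ⟨_, ht0, ht1⟩,
    isAlgebraicallyMaximal_of_relativelyAlgebraicallyClosed isAlgebraic_L₀ hv
      ⟨_, ht0, ht1, fun c hc ↦ Valued.toNormedField.norm_le_iff.2 ?_⟩⟩
  have hc' := Valued.toNormedField.norm_lt_one_iff.1 hc
  change vF c ≤ vF (tSeries p)
  rw [valuation_tSeries, ← WithZero.lt_mul_exp_iff_le WithZero.exp_ne_zero, ← WithZero.exp_add]
  exact hc'

/-- The residue field of `𝔽_p((t))` is `𝔽_p`. -/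
lemma exists_natCast_valuation_sub_lt_one {a : (ZMod p)⸨X⸩} (ha : vF a ≤ 1) :
    ∃ k : ℕ, vF (a - k) ≤ WithZero.exp (-1) := by
  rw [← WithZero.exp_zero, ← neg_zero, LaurentSeries.valuation_le_iff_coeff_lt_eq_zero] at ha
  refine ⟨(a.coeff 0).val, (LaurentSeries.valuation_le_iff_coeff_lt_eq_zero _).2 fun n hn ↦ ?_⟩
  have hC : (((a.coeff 0).val : ℕ) : (ZMod p)⸨X⸩) = HahnSeries.single 0 (a.coeff 0) := by
    rw [← map_natCast (HahnSeries.C (Γ := ℤ)), ZMod.natCast_zmod_val]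
    rfl
  rw [hC, HahnSeries.coeff_sub]
  rcases (Int.lt_add_one_iff.1 hn : n ≤ 0).lt_or_eq with h | rfl
  · rw [ha n h, HahnSeries.coeff_single_of_ne h.ne, sub_zero]
  · rw [HahnSeries.coeff_single_same, sub_self]

/-- `L₀` is dense in `𝔽_p((t))`. -/
lemma exists_valuation_sub_le (z : (ZMod p)⸨X⸩) (n : ℕ) :
    ∃ a : L₀ p x y, vF (z - a) ≤ vF z * WithZero.exp (-1) ^ n := by
  induction n with
  | zero => exact ⟨0, by simp⟩
  | succ n ih =>
    obtain ⟨a, ha⟩ := ih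
    rcases eq_or_ne (z - a) 0 with h0 | h0
    · exact ⟨a, by simp [h0]⟩
    have hne := (Valuation.ne_zero_iff vF).2 h0
    -- `m` is the order in t of the error; the residue of the error divided by t^m is the next
    -- digit.
    set m := -WithZero.log (vF (z - a)) with hm
    have htm : vF (tSeries p ^ m) = vF (z - a) := by
      rw [map_zpow₀, valuation_tSeries, ← WithZero.exp_zsmul, hm]
      simp [WithZero.exp_log hne]
    obtain ⟨k, hk⟩ := exists_natCast_valuation_sub_lt_one
      (a := (z - (a : (ZMod p)⸨X⸩)) / tSeries p ^ m)
      (by rw [map_div₀, htm, div_self hne])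
    refine ⟨a + k * t p x y ^ m, ?_⟩
    have hne' : tSeries p ^ m ≠ 0 := by rwa [← Valuation.ne_zero_iff vF, htm]
    have e : z - ((a + k * t p x y ^ m : L₀ p x y) : (ZMod p)⸨X⸩) =
        ((z - (a : (ZMod p)⸨X⸩)) / tSeries p ^ m - k) * tSeries p ^ m := by
      rw [sub_mul, div_mul_cancel₀ _ hne']
      rw [← Subfield.coe_subtype, map_add, map_mul, map_natCast, map_zpow₀, ← sub_sub]
      rfl
    rw [e, map_mul, htm, pow_succ, ← mul_assoc, mul_comm]
    exact mul_le_mul' ha hk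

section Roots

variable {Ω : Type*} [Field Ω] [Algebra (L₀ p x y) Ω] {Γ : Type*}
  [LinearOrderedCommGroupWithZero Γ] {w : Valuation Ω Γ} [hw : (v₀ p x y).HasExtension w]

lemma valuation_algebraMap_eq_zpow {a : L₀ p x y} (ha : a ≠ 0) :
    ∃ k : ℤ, w (algebraMap _ Ω a) = w (algebraMap _ Ω (t p x y)) ^ k := by
  refine ⟨-WithZero.log (v₀ p x y a), ?_⟩
  rw [← map_zpow₀, ← map_zpow₀, Valuation.HasExtension.val_map_eq_iff (v₀ p x y) w, map_zpow₀,
    v₀_t, ← WithZero.exp_zsmul]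
  simp [WithZero.exp_log ((Valuation.ne_zero_iff (v₀ p x y)).2 ha)]

end Roots

end DelonExample

/-! ### Ramification, residue fields and defect inside `L₀ ^ (1 / p)` -/

namespace DelonExample

open ValuedField MonoidWithZeroHom

variable {p : ℕ} [hp : Fact p.Prime] {x y : (ZMod p)⸨X⸩}

local notation "vF" => (Valued.v : Valuation (ZMod p)⸨X⸩ (WithZero (Multiplicative ℤ)))

lemma natCast_pow_char {R : Type*} [CommSemiring R] [CharP R p] (k : ℕ) : (k : R) ^ p = k := by
  rw [← frobenius_def, map_natCast]

lemma charP_of_algebra_L₀ (p : ℕ) [Fact p.Prime] (x y : (ZMod p)⸨X⸩) (Ω : Type*) [Field Ω]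
    [Algebra (L₀ p x y) Ω] : CharP Ω p :=
  have := charP_L₀ (x := x) (y := y)
  charP_of_injective_algebraMap' (L₀ p x y) p

section Roots

variable {Ω : Type*} [Field Ω] [Algebra (L₀ p x y) Ω]

/-- The subfield of `p`-th roots of elements of `L₀`. -/
noncomputable def rootField (p : ℕ) [Fact p.Prime] (x y : (ZMod p)⸨X⸩) (Ω : Type*) [Field Ω]
    [Algebra (L₀ p x y) Ω] : IntermediateField (L₀ p x y) Ω :=
  have := charP_of_algebra_L₀ p x y Ω
  Subfield.toIntermediateField ((algebraMap (L₀ p x y) Ω).fieldRange.comap (frobenius Ω p))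
    fun a ↦ ⟨a ^ p, map_pow _ _ _⟩

lemma mem_rootField {z : Ω} :
    z ∈ rootField p x y Ω ↔ z ^ p ∈ Set.range (algebraMap (L₀ p x y) Ω) := Iff.rfl

lemma adjoin_eq_rootField (h : AlgebraicIndependent (RatSubfield p) ![x, y]) {τ σ : Ω}
    (hτ : τ ^ p = algebraMap (L₀ p x y) Ω (t p x y))
    (hσ : σ ^ p = algebraMap (L₀ p x y) Ω (s p x y)) :
    (L₀ p x y)⟮τ, σ⟯ = rootField p x y Ω := by
  have := charP_of_algebra_L₀ p x y Ω
  refine le_antisymm (IntermediateField.adjoin_le_iff.2 ?_) fun z hz ↦ ?_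
  · rintro _ (rfl | rfl)
    exacts [⟨_, hτ.symm⟩, ⟨_, hσ.symm⟩]
  · obtain ⟨a, ha⟩ := mem_rootField.1 hz
    obtain ⟨e, he, hea⟩ := exists_pow_eq_algebraMap h hτ hσ a
    rwa [← frobenius_inj Ω p (hea.trans ha)]

lemma isPurelyInseparable_of_le_rootField {M : IntermediateField (L₀ p x y) Ω}
    (hM : M ≤ rootField p x y Ω) : IsPurelyInseparable (L₀ p x y) M := by
  have := charP_L₀ (x := x) (y := y)
  refine (isPurelyInseparable_iff_pow_mem _ p).2 fun z ↦ ⟨1, ?_⟩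
  obtain ⟨a, ha⟩ := hM z.2
  refine ⟨a, Subtype.ext ?_⟩
  rw [pow_one]
  exact ha

variable {Γ : Type*} [LinearOrderedCommGroupWithZero Γ] {w : Valuation Ω Γ}

lemma ne_zero_of_valuation_pow_eq {n : Ω}
    (hn : w n ^ p = w (algebraMap (L₀ p x y) Ω (t p x y))) : w n ≠ 0 := by
  intro h0
  rw [h0, zero_pow hp.out.ne_zero, eq_comm, Valuation.zero_iff, map_eq_zero] at hn
  have := v₀_t (x := x) (y := y)
  rw [hn, map_zero] at this
  exact WithZero.exp_ne_zero this.symm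

lemma valuation_t_lt_one (hw : (v₀ p x y).HasExtension w) :
    w (algebraMap (L₀ p x y) Ω (t p x y)) < 1 := by
  rw [Valuation.HasExtension.val_map_lt_one_iff (v₀ p x y) w, v₀_t, ← WithZero.exp_zero,
    WithZero.exp_lt_exp]
  simp

/-- A natural number `k` congruent to `u ^ p` works for `u` too, because (u - k)^p = u^p - k in
characteristic p. -/
lemma exists_natCast_valuation_sub_lt_one_of_mem_rootField
    (hw : (v₀ p x y).HasExtension w) {u : Ω} (hu : u ∈ rootField p x y Ω)
    (hu1 : w u ≤ 1) : ∃ k : ℕ, w (u - k) < 1 := by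
  have := charP_of_algebra_L₀ p x y Ω
  obtain ⟨a, ha⟩ := mem_rootField.1 hu
  have ha1 : v₀ p x y a ≤ 1 := by
    rw [← Valuation.HasExtension.val_map_le_one_iff (v₀ p x y) w, ha, map_pow]
    exact pow_le_one₀ zero_le hu1
  obtain ⟨k, hk⟩ := exists_natCast_valuation_sub_lt_one (a := (a : (ZMod p)⸨X⸩)) ha1
  refine ⟨k, ?_⟩
  rw [← pow_lt_one_iff_of_nonneg zero_le hp.out.ne_zero, ← map_pow, sub_pow_char,
    natCast_pow_char, ← ha, ← map_natCast (algebraMap (L₀ p x y) Ω), ← map_sub,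
    Valuation.HasExtension.val_map_lt_one_iff (v₀ p x y) w]
  refine lt_of_le_of_lt (b := WithZero.exp (-1)) ?_ ?_
  · rw [v₀_apply]
    convert hk using 2
    rw [← Subfield.coe_subtype, map_sub, map_natCast]
  · rw [← WithZero.exp_zero, WithZero.exp_lt_exp]
    simp

/-- The p-th power of any nonzero value is a power of w(t) = w(n)^p, and p-th roots are unique in an
ordered group. A general `f` allows use both for a subextension of `L₀ ^ (1 / p)` and for `L₀ ^ (1 /
p)` as an extension of it. -/
lemma valueGroup_comap_eq_zpowers (hw : (v₀ p x y).HasExtension w)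
    {M : Type*} [Field M] (f : M →+* Ω)
    (hM : ∀ z, f z ∈ rootField p x y Ω) {g : Γˣ}
    (hg : (g : Γ) ^ p = w (algebraMap (L₀ p x y) Ω (t p x y)))
    {n : M} (hn : w (f n) ^ p = w (algebraMap (L₀ p x y) Ω (t p x y))) :
    valueGroup (.ofClass (w.comap f)) = Subgroup.zpowers g := by
  refine valueGroup_eq_zpowers (w.comap f) (n := n) ?_ fun a ha ↦ ?_
  · exact (pow_left_inj₀ zero_le zero_le hp.out.ne_zero).1 (hn.trans hg.symm)
  · obtain ⟨b, hb⟩ := mem_rootField.1 (hM a)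
    have hb0 : b ≠ 0 := by
      rintro rfl
      rw [map_zero, eq_comm, pow_eq_zero_iff hp.out.ne_zero, map_eq_zero] at hb
      exact ha hb
    obtain ⟨k, hk⟩ := valuation_algebraMap_eq_zpow (w := w) hb0
    refine ⟨k, (pow_left_inj₀ zero_le zero_le hp.out.ne_zero).1 ?_⟩
    rw [Valuation.comap_apply, Valuation.comap_apply, ← map_pow, ← hb, hk, ← hn, ← zpow_natCast,
      ← zpow_natCast, ← zpow_mul, ← zpow_mul, mul_comm]

lemma baseValueGroup_eq_zpowers (hw : (v₀ p x y).HasExtension w)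
    (M : IntermediateField (L₀ p x y) Ω) {g : Γˣ}
    (hg : (g : Γ) ^ p = w (algebraMap (L₀ p x y) Ω (t p x y))) :
    baseValueGroup (L₀ p x y) (w.comap (algebraMap M Ω)) = Subgroup.zpowers (g ^ p) := by
  refine valueGroup_eq_zpowers _ (n := t p x y) ?_ fun a ha ↦ ?_
  · rw [Units.val_pow_eq_pow_val, hg]
    rfl
  · exact valuation_algebraMap_eq_zpow (w := w) ha

lemma ramificationIndex_eq (hw : (v₀ p x y).HasExtension w)
    {M : IntermediateField (L₀ p x y) Ω} (hM : M ≤ rootField p x y Ω)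
    {n : Ω} (hnM : n ∈ M) (hn : w n ^ p = w (algebraMap (L₀ p x y) Ω (t p x y))) :
    ramificationIndex (L₀ p x y) (w.comap (algebraMap M Ω)) = p := by
  have hn0 : w n ≠ 0 := ne_zero_of_valuation_pow_eq hn
  rw [ramificationIndex, baseValueGroup_eq_zpowers hw M (g := Units.mk0 (w n) hn0) hn,
    valueGroup_comap_eq_zpowers hw (algebraMap M Ω) (fun z ↦ hM z.2) (g := Units.mk0 (w n) hn0) hn
      (n := ⟨n, hnM⟩) hn, relIndex_zpowers_pow]
  rw [isOfFinOrder_iff_pow_eq_one]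
  rintro ⟨m, hm, h⟩
  have h1 := congrArg Units.val h
  rw [Units.val_pow_eq_pow_val, Units.val_mk0, Units.val_one,
    pow_eq_one_iff_of_nonneg zero_le hm.ne'] at h1
  have := valuation_t_lt_one hw
  rw [← hn, h1, one_pow] at this
  exact this.false

lemma residueDegree_eq (hw : (v₀ p x y).HasExtension w)
    {M : IntermediateField (L₀ p x y) Ω} (hM : M ≤ rootField p x y Ω) :
    residueDegree (L₀ p x y) (w.comap (algebraMap M Ω)) = 1 :=
  residueDegree_eq_one _ fun u hu ↦ by
    obtain ⟨k, hk⟩ := exists_natCast_valuation_sub_lt_one_of_mem_rootField hw (hM u.2) hu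
    exact ⟨k, hk⟩

/-- The extension `L₀(σ)` contains an element with the same value as `τ`. -/
lemma exists_valuation_pow_eq (hw : (v₀ p x y).HasExtension w) (hy : y ≠ 0) {σ : Ω}
    (hσ : σ ^ p = algebraMap (L₀ p x y) Ω (s p x y)) :
    ∃ n ∈ (L₀ p x y)⟮σ⟯, w n ^ p = w (algebraMap (L₀ p x y) Ω (t p x y)) := by
  have := charP_of_algebra_L₀ p x y Ω
  have := charP_L₀ (x := x) (y := y)
  have hvy := (Valuation.ne_zero_iff vF).2 hy
  -- By density, take `a` closer to `x` than the value of `y` by one further factor t. Since p > 1,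
  -- (x - a)^p is then negligible against t y^p.
  obtain ⟨x', hx'⟩ : ∃ a : L₀ p x y, vF ((x - a) ^ p) < vF (tSeries p * y ^ p) := by
    obtain ⟨a, ha⟩ := exists_valuation_sub_le (x := x) (y := y) x
      (WithZero.log (vF x) - WithZero.log (vF y) + 1).toNat
    have ha' : vF (x - a) ≤ vF y * WithZero.exp (-1) := by
      refine ha.trans ?_
      rcases eq_or_ne (vF x) 0 with h0 | h0
      · simp [h0]
      rw [← WithZero.exp_log h0, ← WithZero.exp_log hvy, ← WithZero.exp_nsmul, ← WithZero.exp_add,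
        ← WithZero.exp_add, WithZero.exp_le_exp]
      simp only [WithZero.log_exp, nsmul_eq_mul]
      have := Int.self_le_toNat (WithZero.log (vF x) - WithZero.log (vF y) + 1)
      linarith
    refine ⟨a, ?_⟩
    rw [map_pow, map_mul, map_pow, valuation_tSeries, mul_comm]
    refine (pow_le_pow_left₀ zero_le ha' p).trans_lt ?_
    rw [mul_pow]
    refine mul_lt_mul_of_pos_left ?_ (pow_pos (zero_lt_iff.2 hvy) _)
    rw [← WithZero.exp_nsmul, WithZero.exp_lt_exp]
    have : (1 : ℤ) < p := by exact_mod_cast hp.out.one_lt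
    simp only [nsmul_eq_mul]
    linarith
  let y' := t p x y ^ (-WithZero.log (vF y))
  have hy' : v₀ p x y y' = vF y := by
    rw [map_zpow₀, v₀_t, ← WithZero.exp_zsmul]
    simp [WithZero.exp_log hvy]
  -- The p-th power of this element is ((x - x')^p + t y^p) / y'^p, which has the value of `t`.
  refine ⟨(σ - algebraMap _ Ω x') / algebraMap _ Ω y',
    div_mem (sub_mem (IntermediateField.mem_adjoin_simple_self _ _)
      (IntermediateField.algebraMap_mem _ _)) (IntermediateField.algebraMap_mem _ _), ?_⟩
  rw [← map_pow, div_pow, sub_pow_char, hσ, ← map_pow, ← map_pow, ← map_sub, ← map_div₀,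
    Valuation.HasExtension.val_map_eq_iff (v₀ p x y) w, map_div₀, map_pow, hy', v₀_apply]
  have e : ((s p x y - x' ^ p : L₀ p x y) : (ZMod p)⸨X⸩) =
      (x - x') ^ p + tSeries p * y ^ p := by
    rw [sub_pow_char]
    change x ^ p + tSeries p * y ^ p - (x' : (ZMod p)⸨X⸩) ^ p = _
    ring
  rw [e, Valuation.map_add_eq_of_lt_right _ hx', map_mul, map_pow,
    mul_div_cancel_right₀ _ (pow_ne_zero _ hvy)]
  rfl

/-- A proper subextension of `L₀ ^ (1 / p)` with the same value group is not algebraically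
maximal. -/
lemma not_isAlgebraicallyMaximal {Ω : Type} [Field Ω] [Algebra (L₀ p x y) Ω]
    [Algebra.IsAlgebraic (L₀ p x y) Ω] {Γ : Type} [LinearOrderedCommGroupWithZero Γ]
    {w : Valuation Ω Γ} (hw : (v₀ p x y).HasExtension w) {M : IntermediateField (L₀ p x y) Ω}
    (hM : M < rootField p x y Ω)
    {n : Ω} (hnM : n ∈ M) (hn : w n ^ p = w (algebraMap (L₀ p x y) Ω (t p x y))) :
    ¬ IsAlgebraicallyMaximal (w.comap (algebraMap M Ω)) := by
  intro hmax
  let N : IntermediateField M Ω := IntermediateField.extendScalars hM.le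
  have hN (z : N) : algebraMap N Ω z ∈ rootField p x y Ω := z.2
  have : Algebra.IsAlgebraic M Ω := Algebra.IsAlgebraic.tower_top (K := L₀ p x y) M
  have hn0 : w n ≠ 0 := ne_zero_of_valuation_pow_eq hn
  -- Both value groups are generated by `w n`, and both residue fields are prime.
  have himm : IsImmediate M (w.comap (algebraMap N Ω)) := by
    refine ⟨?_, surjective_algebraMap_residueField _ fun u hu ↦ ?_⟩
    · rw [valueGroup_comap_eq_zpowers hw (algebraMap N Ω) hN (g := Units.mk0 (w n) hn0) hn
        (n := algebraMap M N ⟨n, hnM⟩) hn]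
      exact valueGroup_comap_eq_zpowers hw (algebraMap M Ω) (fun z ↦ hM.le z.2)
        (g := Units.mk0 (w n) hn0) hn (n := ⟨n, hnM⟩) hn
    · obtain ⟨k, hk⟩ := exists_natCast_valuation_sub_lt_one_of_mem_rootField hw (hN u) hu
      exact ⟨k, hk⟩
  have hsurj := hmax N inferInstance Γ (w.comap (algebraMap N Ω)) ⟨Valuation.IsEquiv.refl⟩ himm
  refine hM.not_ge fun z hz ↦ ?_
  obtain ⟨m, hm⟩ := hsurj ⟨z, hz⟩
  have := congrArg (algebraMap N Ω) hm
  exact Eq.mp (congrArg (· ∈ M) this) m.2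

lemma pow_ne_s (h : AlgebraicIndependent (RatSubfield p) ![x, y]) (b : L₀ p x y) :
    b ^ p ≠ s p x y := by
  intro hb
  refine sum_pow_mul_pow_ne_s h (Pi.single ⟨0, hp.out.pos⟩ b) ?_
  rw [Finset.sum_eq_single ⟨0, hp.out.pos⟩, Pi.single_eq_same, pow_zero, mul_one, hb]
  · intro i _ hi
    rw [Pi.single_eq_of_ne hi, zero_pow hp.out.ne_zero, zero_mul]
  · simp

lemma defect_adjoin_pair (h : AlgebraicIndependent (RatSubfield p) ![x, y])
    (hw : (v₀ p x y).HasExtension w) {τ σ : Ω}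
    (hτ : τ ^ p = algebraMap (L₀ p x y) Ω (t p x y))
    (hσ : σ ^ p = algebraMap (L₀ p x y) Ω (s p x y)) :
    Module.finrank (L₀ p x y) (L₀ p x y)⟮τ, σ⟯ = p ^ 2 ∧
    ramificationIndex (L₀ p x y) (w.comap (algebraMap (L₀ p x y)⟮τ, σ⟯ Ω)) = p ∧
    residueDegree (L₀ p x y) (w.comap (algebraMap (L₀ p x y)⟮τ, σ⟯ Ω)) = 1 ∧
    defect (L₀ p x y) (w.comap (algebraMap (L₀ p x y)⟮τ, σ⟯ Ω)) = p := by
  have := charP_L₀ (x := x) (y := y)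
  have hle := (adjoin_eq_rootField h hτ hσ).le
  have h1 := PthRoots.finrank_adjoin_pair pow_ne_t (sum_pow_mul_pow_ne_s h) hτ hσ
  have h2 := ramificationIndex_eq hw hle (n := τ) (IntermediateField.subset_adjoin _ _ (by simp))
    (by rw [← map_pow, hτ])
  have h3 := residueDegree_eq hw hle
  refine ⟨h1, h2, h3, ?_⟩
  rw [defect, h1, h2, h3]
  have : (p : ℚ) ≠ 0 := by exact_mod_cast hp.out.ne_zero
  push_cast
  field_simp

end Roots

lemma not_isInseparablyDefectless_and_not_isDefectless
    (h : AlgebraicIndependent (RatSubfield p) ![x, y]) :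
    ¬ IsInseparablyDefectless (v₀ p x y) ∧ ¬ IsDefectless (v₀ p x y) := by
  have hhens := (isHenselian_and_isAlgebraicallyMaximal_v₀ (x := x) (y := y)).1
  obtain ⟨Γ, _, w, hw⟩ := (hhens (AlgebraicClosure (L₀ p x y)) inferInstance).1
  obtain ⟨τ, hτ⟩ := IsAlgClosed.exists_pow_nat_eq
    (algebraMap (L₀ p x y) (AlgebraicClosure (L₀ p x y)) (t p x y)) hp.out.pos
  obtain ⟨σ, hσ⟩ := IsAlgClosed.exists_pow_nat_eq
    (algebraMap (L₀ p x y) (AlgebraicClosure (L₀ p x y)) (s p x y)) hp.out.pos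
  obtain ⟨hrank, -, -, hdef⟩ := defect_adjoin_pair h hw hτ hσ
  have hfin : FiniteDimensional (L₀ p x y) (L₀ p x y)⟮τ, σ⟯ :=
    Module.finite_of_finrank_pos (by rw [hrank]; exact pow_pos hp.out.pos 2)
  have hext : (v₀ p x y).HasExtension (w.comap (algebraMap (L₀ p x y)⟮τ, σ⟯ _)) :=
    ⟨hw.val_isEquiv_comap⟩
  have hne : (p : ℚ) ≠ 1 := by exact_mod_cast hp.out.ne_one
  refine ⟨fun hd ↦ hne ?_, fun hd ↦ hne ?_⟩
  · rw [← hdef]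
    exact hd _ hfin (isPurelyInseparable_of_le_rootField (adjoin_eq_rootField h hτ hσ).le) _ _ hext
  · rw [← hdef]
    exact hd _ hfin (hhens _ inferInstance) _ _ hext

end DelonExample

open ValuedField DelonExample in
theorem theorem1p1 (p : ℕ) [Fact p.Prime] :
    (∃ x y : (ZMod p)⸨X⸩, AlgebraicIndependent (RatSubfield p) ![x, y]) ∧
    ∀ x y : (ZMod p)⸨X⸩, AlgebraicIndependent (RatSubfield p) ![x, y] →
      CharP (L₀ p x y) p ∧
      (v₀ p x y).IsRankOneDiscrete ∧
      IsHenselian (v₀ p x y) ∧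
      IsAlgebraicallyMaximal (v₀ p x y) ∧
      ¬ IsInseparablyDefectless (v₀ p x y) ∧
      ¬ IsDefectless (v₀ p x y) ∧
      ∀ (Ω : Type) [Field Ω] [Algebra (L₀ p x y) Ω] [IsAlgClosure (L₀ p x y) Ω]
        (Γ : Type) [LinearOrderedCommGroupWithZero Γ] (w : Valuation Ω Γ),
        (v₀ p x y).HasExtension w →
        ∀ τ σ : Ω, τ ^ p = algebraMap (L₀ p x y) Ω (t p x y) →
          σ ^ p = algebraMap (L₀ p x y) Ω (s p x y) →
          -- `L₀(τ, σ)` is `L₀ ^ (1 / p)`, the field of `p`-th roots of elements of `L₀`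
          (((L₀ p x y)⟮τ, σ⟯ : Set Ω) =
            {z | z ^ p ∈ Set.range (algebraMap (L₀ p x y) Ω)}) ∧
          IsPurelyInseparable (L₀ p x y) (L₀ p x y)⟮τ, σ⟯ ∧
          IsUnibranched (v₀ p x y) (L₀ p x y)⟮τ, σ⟯ ∧
          Module.finrank (L₀ p x y) (L₀ p x y)⟮τ, σ⟯ = p ^ 2 ∧
          ramificationIndex (L₀ p x y) (w.comap (algebraMap (L₀ p x y)⟮τ, σ⟯ Ω)) = p ∧
          residueDegree (L₀ p x y) (w.comap (algebraMap (L₀ p x y)⟮τ, σ⟯ Ω)) = 1 ∧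
          defect (L₀ p x y) (w.comap (algebraMap (L₀ p x y)⟮τ, σ⟯ Ω)) = p ∧
          ∀ z ∈ ({τ, σ} : Set Ω),
            IsPurelyInseparable (L₀ p x y) (L₀ p x y)⟮z⟯ ∧
            Module.finrank (L₀ p x y) (L₀ p x y)⟮z⟯ = p ∧
            defect (L₀ p x y) (w.comap (algebraMap (L₀ p x y)⟮z⟯ Ω)) = 1 ∧
            ¬ IsAlgebraicallyMaximal (w.comap (algebraMap (L₀ p x y)⟮z⟯ Ω)) := by

  refine ⟨exists_algebraicIndependent_pair p, fun x y h ↦ ?_⟩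
  obtain ⟨hhens, hmax⟩ := isHenselian_and_isAlgebraicallyMaximal_v₀ (p := p) (x := x) (y := y)
  obtain ⟨hins, hdefl⟩ := not_isInseparablyDefectless_and_not_isDefectless h
  refine ⟨charP_L₀, isRankOneDiscrete_v₀, hhens, hmax, hins, hdefl, ?_⟩
  intro Ω _ _ _ Γ _ w hw τ σ hτ hσ
  have hp := Fact.out (p := p.Prime)
  have : Algebra.IsAlgebraic (L₀ p x y) Ω := IsAlgClosure.isAlgebraic
  have hE := adjoin_eq_rootField h hτ hσ
  obtain ⟨h1, h2, h3, h4⟩ := defect_adjoin_pair h hw hτ hσ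
  refine ⟨by rw [hE]; rfl, isPurelyInseparable_of_le_rootField hE.le, hhens _ inferInstance,
    h1, h2, h3, h4, ?_⟩
  intro z hz
  have hy : y ≠ 0 := h.ne_zero 1
  obtain ⟨hz', hrank, n, hnz, hn⟩ : z ^ p ∈ Set.range (algebraMap (L₀ p x y) Ω) ∧
      Module.finrank (L₀ p x y) (L₀ p x y)⟮z⟯ = p ∧
      ∃ n ∈ (L₀ p x y)⟮z⟯, w n ^ p = w (algebraMap (L₀ p x y) Ω (t p x y)) := by
    rcases hz with rfl | rfl
    · exact ⟨⟨_, hτ.symm⟩, PthRoots.finrank_adjoin pow_ne_t hτ, z,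
        IntermediateField.mem_adjoin_simple_self _ _, by rw [← map_pow, hτ]⟩
    · exact ⟨⟨_, hσ.symm⟩, PthRoots.finrank_adjoin (pow_ne_s h) hσ,
        exists_valuation_pow_eq hw hy hσ⟩
  have hle : (L₀ p x y)⟮z⟯ ≤ rootField p x y Ω :=
    IntermediateField.adjoin_simple_le_iff.2 (mem_rootField.2 hz')
  -- Properness follows from the degrees, p against p².
  have hlt : (L₀ p x y)⟮z⟯ < rootField p x y Ω := by
    refine lt_of_le_of_ne hle fun heq ↦ ?_
    rw [← heq] at hE
    rw [hE, hrank] at h1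
    exact absurd h1 (by rw [sq]; exact (lt_mul_of_one_lt_left hp.pos hp.one_lt).ne)
  refine ⟨isPurelyInseparable_of_le_rootField hle, hrank, ?_,
    not_isAlgebraicallyMaximal hw hlt hnz hn⟩
  rw [defect, hrank, ramificationIndex_eq hw hle hnz hn, residueDegree_eq hw hle, Nat.cast_one,
    mul_one, div_self (by exact_mod_cast hp.ne_zero)]
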